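/- **Proposition (Picard–Kummer kernel on smooth trace/norm curves).** Let $F=\mathbb F_q$ be a finite field of characteristic different from $2$ and $3$, let $B/F$ be a finite étale algebra of degree $3$, and let $T_B=\ker(\mathrm N_{B/F}:\mathrm{Res}_{B/F}\mathbb G_m\to\mathbb G_m)$ be its norm-one torus. Let $s\in F$ and $n\in F^\times$ with $s^3\ne 27n$. Put $X_n=\{x\in \mathrm{Res}_{B/F}\mathbb G_m:\mathrm N(x)=n\}$, a $T_B$-torsor, and let $U\subset X_n$ be the affine curve $\mathrm{Tr}(x)=s$, $\mathrm N(x)=n$. Let $\ell\ne\operatorname{char}F$ be a prime. For every $x_0\in X_n(\overline F)$ let $\theta_{x_0}:U_{\overline F}\to T_{B,\overline F}$ be $x\mapsto x_0^{-1}x$. After an ordering of the three embeddings $B\to\overline F$, write $x_1,x_2,x_3$ (respectively $t_1,t_2,t_3$) for the resulting coordinates on $X_{n,\overline F}$ (respectively on $T_{B,\overline F}:t_1t_2t_3=1$). 1. For a character $\chi:T_B(F)\to\overline{\mathbb Q}_\ell^\times$, let $\mathcal L_\chi$ be the $\chi$-isotypic rank-one summand of $L_*\overline{\mathbb Q}_\ell$,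 where $L:T_B\to T_B$, $L(t)=\mathrm{Frob}_q(t)t^{-1}$, is the Lang map. Then, for every $x_0\in X_n(\overline F)$, the sheaf $\theta_{x_0}^*\mathcal L_\chi$ is trivial on $U_{\overline F}$ if and only if $\chi=1$. 2. Let $N\ge1$ be prime to $\operatorname{char}F$, let $\psi:\mu_N(\overline F)\to\overline{\mathbb Q}_\ell^\times$ be a faithful character, and let $(a_1,a_2,a_3)\in\mathbb Z^3$. Let $\mathcal K$ be the Kummer sheaf on $T_{B,\overline F}$ attached to $\psi$ and to the $\mu_N$-torsor $y^N=t_1^{a_1}t_2^{a_2}t_3^{a_3}$. Then, for every $x_0\in X_n(\overline F)$, the sheaf $\theta_{x_0}^*\mathcal K$ is trivial on $U_{\overline F}$ if and only if $a_1\equiv a_2\equiv a_3\pmod N$. 3. The coordinate ring of $U_{\overline F}$ is an integral domain. For every $N\ge1$ prime to $\operatorname{char}F$ and every $(a_1,a_2,a_3)\in\mathbb Z^3$, the function $x_1^{a_1}x_2^{a_2}x_3^{a_3}$ is an invertible regular function on $U_{\overline F}$, and it is an $N$-th power in the function field $\overline F(U)$ if and only if $a_1\equiv a_2\equiv a_3\pmod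 N$. In particular, every nontrivial character sheaf on $T_B$ pulls back geometrically nontrivially to every smooth trace/norm curve, whichever geometric trivialization of the torsor $X_n$ is used. -/

import Mathlib

open scoped TensorProduct

namespace TraceNorm

/-! Classical algebraic sets over a field. -/

section Zariski

variable (k : Type*) {X V : Type*} [Field k] [AddCommGroup V] [Module k V]

/-- The ring of regular functions on a set `X` which sits in the affine space `V` through `i`:
the restrictions to `X` of the polynomial functions on `V`. -/
def regularFunctions (i : X → V) : Subalgebra k (X → k) :=
  Algebra.adjoin k (Set.range fun (l : Module.Dual k V) (x : X) => l (i x))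

/-- The Zariski topology on `X`: the non-vanishing loci of regular functions form a basis. -/
@[reducible] def zariskiTopology (i : X → V) : TopologicalSpace X :=
  TopologicalSpace.generateFrom {O | ∃ f ∈ regularFunctions k i, O = {x | f x ≠ 0}}

end Zariski

/-! Rank-one sheaves attached to a torsor and a character of its group. -/

section RankOne

variable {G E : Type*} (W : Type*) [Group G] [MulAction G W] [TopologicalSpace W] [Field E]

/-- Let `π : W → U` be a finite étale torsor under the finite group `G` and `χ` a character of `G`.
These are the global sections over `U` of the `χ`-isotypic summand of the direct image `π_* E`
of the constant sheaf: the locally constant functions on `W` on which `G` acts through `χ`. -/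
def isotypicSections (χ : G →* Eˣ) : Submodule E (W → E) where
  carrier := {f | IsLocallyConstant f ∧ ∀ (g : G) (w : W), f (g • w) = (χ g : E) * f w}
  add_mem' := by
    rintro f f' ⟨hf, hf'⟩ ⟨hg, hg'⟩
    exact ⟨hf.add hg, fun g w => by simp only [Pi.add_apply, hf', hg', mul_add]⟩
  zero_mem' := ⟨IsLocallyConstant.const 0, fun g w => by simp⟩
  smul_mem' := by
    rintro c f ⟨hf, hf'⟩
    exact ⟨hf.comp (fun y => c * y), fun g w => by
      simp only [Pi.smul_apply, smul_eq_mul, hf', mul_left_comm]⟩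

/-- The `χ`-isotypic summand of `π_* E` is isomorphic to the constant sheaf `E`.  A morphism from
the constant sheaf to it is a global section, and it is an isomorphism exactly when that section
vanishes nowhere. -/
def IsTrivialRankOne (χ : G →* Eˣ) : Prop :=
  ∃ f ∈ isotypicSections W χ, ∀ w, f w ≠ 0

end RankOne

/-! The norm-one torus and its Lang map. -/

/-- The points of the norm-one torus of the algebra `R` over the field `K`. -/
noncomputable def normOneTorus (K R : Type*) [Field K] [CommRing R] [Algebra K R] : Subgroup Rˣ :=
  (Units.map (Algebra.norm K : R →* K)).ker

section Torus

variable (F B : Type*) [Field F] [CommRing B] [Algebra F B]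

/-- The base change of `B` to an algebraic closure of `F`. -/
abbrev GeomAlg := AlgebraicClosure F ⊗[F] B

/-- Extension of scalars on unit groups. -/
noncomputable def baseChangeUnits : Bˣ →* (GeomAlg F B)ˣ :=
  Units.map (Algebra.TensorProduct.includeRight : B →ₐ[F] GeomAlg F B)

variable [Fintype F]

/-- The arithmetic Frobenius `x ↦ x ^ q` on scalars, acting on `F̄ ⊗ B`. -/
noncomputable def frob : GeomAlg F B ≃ₐ[F] GeomAlg F B :=
  Algebra.TensorProduct.congr
    (FiniteField.frobeniusAlgEquivOfAlgebraic F (AlgebraicClosure F)) AlgEquiv.refl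

theorem norm_frob (x : GeomAlg F B) :
    Algebra.norm (AlgebraicClosure F) (frob F B x) =
      FiniteField.frobeniusAlgEquivOfAlgebraic F (AlgebraicClosure F)
        (Algebra.norm (AlgebraicClosure F) x) := by
  have h := Algebra.norm_eq_of_equiv_equiv
    (FiniteField.frobeniusAlgEquivOfAlgebraic F (AlgebraicClosure F)).toRingEquiv
    (frob F B).toRingEquiv (by
      ext c
      simp [frob, Algebra.TensorProduct.algebraMap_apply]) x
  rw [h]
  exact ((FiniteField.frobeniusAlgEquivOfAlgebraic F
    (AlgebraicClosure F)).apply_symm_apply _).symm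

/-- Arithmetic Frobenius on the geometric points of the norm-one torus. -/
noncomputable def frobTorus :
    normOneTorus (AlgebraicClosure F) (GeomAlg F B) →*
      normOneTorus (AlgebraicClosure F) (GeomAlg F B) :=
  ((Units.map (frob F B : GeomAlg F B →* GeomAlg F B)).comp (Subgroup.subtype _)).codRestrict _ (by
    intro t
    have ht : Algebra.norm (AlgebraicClosure F) ((t : (GeomAlg F B)ˣ) : GeomAlg F B) = 1 :=
      congrArg Units.val t.2
    refine Units.ext ?_
    change Algebra.norm (AlgebraicClosure F) (frob F B _) = 1
    rw [norm_frob]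
    exact (congrArg _ ht).trans (map_one _))

/-- The Lang map `t ↦ Frob t * t⁻¹` on the geometric points of the norm-one torus. -/
noncomputable def langMap :
    normOneTorus (AlgebraicClosure F) (GeomAlg F B) →*
      normOneTorus (AlgebraicClosure F) (GeomAlg F B) :=
  frobTorus F B / MonoidHom.id _

end Torus

/-! Trace/norm curves and the pullbacks of character sheaves to them. -/

section Curve

variable (F B : Type*) [Field F] [CommRing B] [Algebra F B]

/-- The geometric points of the norm fibre `N x = n`, a torsor under the norm-one torus. -/
def NormFiber (n : Fˣ) : Type _ :=
  {x : (GeomAlg F B)ˣ // Algebra.norm (AlgebraicClosure F) (x : GeomAlg F B) =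
    algebraMap F (AlgebraicClosure F) n}

/-- The geometric points of the affine trace/norm curve `Tr x = s`, `N x = n`. -/
def Curve (s : F) (n : Fˣ) : Type _ :=
  {x : NormFiber F B n // Algebra.trace (AlgebraicClosure F) (GeomAlg F B) (x.1 : GeomAlg F B) =
    algebraMap F (AlgebraicClosure F) s}

variable {F B} {s : F} {n : Fˣ}

/-- The trivialization `x ↦ x₀⁻¹ x` of the norm fibre by one of its points. -/
noncomputable def trivialization (x₀ x : NormFiber F B n) :
    normOneTorus (AlgebraicClosure F) (GeomAlg F B) :=
  ⟨x₀.1⁻¹ * x.1, by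
    have h : Units.map (Algebra.norm (AlgebraicClosure F) : GeomAlg F B →* AlgebraicClosure F) x₀.1 =
        Units.map (Algebra.norm (AlgebraicClosure F) : GeomAlg F B →* AlgebraicClosure F) x.1 :=
      Units.ext (x₀.2.trans x.2.symm)
    change Units.map (Algebra.norm (AlgebraicClosure F) : GeomAlg F B →* AlgebraicClosure F)
      (x₀.1⁻¹ * x.1) = 1
    rw [map_mul, map_inv, h, inv_mul_cancel]⟩

/-- The coordinate `F̄ ⊗ B → F̄` given by an embedding of `B`; an ordering of the three embeddings
gives the split coordinates `x₁, x₂, x₃`. -/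
noncomputable def coord (σ : B →ₐ[F] AlgebraicClosure F) :
    GeomAlg F B →ₐ[AlgebraicClosure F] AlgebraicClosure F :=
  Algebra.TensorProduct.lift (AlgHom.id _ _) σ fun _ _ => Commute.all _ _

/-- The monomial `x₁ ^ a₁ * x₂ ^ a₂ * x₃ ^ a₃` in the split coordinates. -/
noncomputable def monomial (e : Fin 3 ≃ (B →ₐ[F] AlgebraicClosure F)) (a : Fin 3 → ℤ)
    (x : (GeomAlg F B)ˣ) : (AlgebraicClosure F)ˣ :=
  ∏ i, Units.map (coord (e i) : GeomAlg F B →* AlgebraicClosure F) x ^ a i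

variable (F B s n) in
/-- The ring of regular functions on the trace/norm curve over `F̄`. -/
noncomputable abbrev CurveRing : Subalgebra (AlgebraicClosure F) (Curve F B s n → AlgebraicClosure F) :=
  regularFunctions (AlgebraicClosure F) fun x : Curve F B s n => (x.1.1 : GeomAlg F B)

variable (s) in
/-- The Kummer torsor `y ^ N = t₁ ^ a₁ * t₂ ^ a₂ * t₃ ^ a₃` of the norm-one torus, pulled back to
the trace/norm curve through the trivialization at `x₀`. -/
def KummerCover (e : Fin 3 ≃ (B →ₐ[F] AlgebraicClosure F)) (N : ℕ) (a : Fin 3 → ℤ)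
    (x₀ : NormFiber F B n) : Type _ :=
  {p : Curve F B s n × (AlgebraicClosure F)ˣ //
    p.2 ^ N = monomial e a (trivialization x₀ p.1.1)}

section

variable (e : Fin 3 ≃ (B →ₐ[F] AlgebraicClosure F)) (N : ℕ) (a : Fin 3 → ℤ) (x₀ : NormFiber F B n)

noncomputable instance : TopologicalSpace (KummerCover s e N a x₀) :=
  zariskiTopology (AlgebraicClosure F) (V := GeomAlg F B × AlgebraicClosure F)
    fun p => (p.1.1.1.1, p.1.2)

/-- The group `μ_N` acts on the Kummer torsor through the coordinate `y`. -/
noncomputable instance : MulAction (rootsOfUnity N (AlgebraicClosure F)) (KummerCover s e N a x₀) where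
  smul ζ p := ⟨(p.1.1, ζ.1 * p.1.2), by
    have hζ : ζ.1 ^ N = 1 := ζ.2
    simpa [mul_pow, hζ] using p.2⟩
  one_smul p := Subtype.ext (Prod.ext rfl (one_mul p.1.2))
  mul_smul ζ ξ p := Subtype.ext (Prod.ext rfl (mul_assoc ζ.1 ξ.1 p.1.2))

end

variable [Fintype F]

variable (s) in
/-- The Lang torsor of the norm-one torus, pulled back to the trace/norm curve through the
trivialization at `x₀`. -/
def LangCover (x₀ : NormFiber F B n) : Type _ :=
  {p : Curve F B s n × normOneTorus (AlgebraicClosure F) (GeomAlg F B) //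
    langMap F B p.2 = trivialization x₀ p.1.1}

noncomputable instance (x₀ : NormFiber F B n) : TopologicalSpace (LangCover s x₀) :=
  zariskiTopology (AlgebraicClosure F) (V := GeomAlg F B × GeomAlg F B)
    fun p => (p.1.1.1.1, p.1.2.1)

variable [Module.Finite F B]

variable (F B) in
/-- Rational points of the norm-one torus as geometric points. -/
noncomputable def rationalPoint :
    normOneTorus F B →* normOneTorus (AlgebraicClosure F) (GeomAlg F B) :=
  ((baseChangeUnits F B).comp (Subgroup.subtype _)).codRestrict _ (by
    intro h
    have hh : Algebra.norm F ((h : Bˣ) : B) = 1 := congrArg Units.val h.2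
    have key : Algebra.norm (AlgebraicClosure F) ((1 : AlgebraicClosure F) ⊗ₜ[F] ((h : Bˣ) : B)) =
        algebraMap F (AlgebraicClosure F) (Algebra.norm F ((h : Bˣ) : B)) := by
      rw [Algebra.norm_apply, Algebra.norm_apply, ← LinearMap.det_baseChange]
      congr 1
      ext b
      simp
    rw [hh, map_one] at key
    exact Units.ext key)

theorem langMap_rationalPoint (h : normOneTorus F B) : langMap F B (rationalPoint F B h) = 1 := by
  refine div_eq_one.mpr (Subtype.ext (Units.ext ?_))
  change frob F B (1 ⊗ₜ ((h : Bˣ) : B)) = 1 ⊗ₜ ((h : Bˣ) : B)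
  simp [frob]

/-- The deck group `T(F)` acts on the Lang torsor by multiplication. -/
noncomputable instance (x₀ : NormFiber F B n) : MulAction (normOneTorus F B) (LangCover s x₀) where
  smul h p := ⟨(p.1.1, rationalPoint F B h * p.1.2), by
    simpa [map_mul, langMap_rationalPoint] using p.2⟩
  one_smul p := Subtype.ext (Prod.ext rfl (by
    change rationalPoint F B 1 * p.1.2 = p.1.2
    rw [map_one, one_mul]))
  mul_smul h h' p := Subtype.ext (Prod.ext rfl (by
    change rationalPoint F B (h * h') * p.1.2 = rationalPoint F B h * (rationalPoint F B h' * p.1.2)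
    rw [map_mul, mul_assoc]))

end Curve

end TraceNorm

namespace TraceNorm

/-! ### Radicals in the function field of x + y + z = s, xyz = n. -/

section FunctionField

open Polynomial IntermediateField

variable {k : Type*} [Field k]

/-! All three assertions reduce to one fact about the function field `K` of the smooth plane cubic
x₁ + x₂ + x₃ = s, x₁x₂x₃ = n over an algebraically closed field: a monomial in the xᵢ is an N-th
power only if its exponents agree modulo N. Geometrically, the line at infinity meets the cubic in
three flexes P₁, P₂, P₃, and div x₁ = 2P₁ - P₂ - P₃, and cyclically. Dividing by a power of x₁x₂x₃ =
n leaves x₁^b₁ x₂^b₂, and orders at P₁ and P₂ give r ∣ 2b₁ - b₂ and r ∣ 2b₂ - b₁ for a prime r. This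
settles r ≠ 3. For r = 3 the only remaining danger is x₁/x₂, with divisor 3P₁ - 3P₂: a cube root
would have a single simple pole, so the curve would be rational, against s³ ≠ 27n. The code replaces
divisors by norms to k(x) (`dvd_of_pow_eq_monomial`) and genus by the insolubility of a Hesse cubic
in k(X) (`ratFunc_hesse_ne_zero`, `cube_ne_div`).

By Kummer theory (`exists_galois_apply_eq_mul`) M-th roots tᵢ of suitably scaled coordinates, with
product 1, are multiplied by every triple of M-th roots of unity of product 1 under the Galois
group. The domain generated by the xᵢ and tᵢ then forces a locally constant function on anything
below the root cover to be invariant under these triples at some point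
(`IsTraceNormCurve.exists_twist_eq`).

Both torsors lie below such a cover. For the Kummer torsor take M = N and y = t^a. For the Lang
torsor take M = q^m - 1, where the m-th power of Frobenius fixes all embeddings of B: the product of
m Frobenius conjugates, followed by the Lang map, is the M-th power. A nowhere zero isotypic section
therefore makes the character trivial on the image of the triples, which gives the congruences in
the first case and all of T(F) in the second. -/

theorem dvd_of_ratFunc_pow_eq {c : k} (hc : c ≠ 0) {m : ℤ} {r : ℕ} {g : RatFunc k}
    (h : g ^ r = RatFunc.C c * RatFunc.X ^ m) : (r : ℤ) ∣ m := by
  have hX : (RatFunc.X : RatFunc k) ≠ 0 := RatFunc.X_ne_zero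
  have hC : RatFunc.C c ≠ 0 := by simpa using hc
  have pow_deg (f : RatFunc k) (hf : f ≠ 0) (i : ℕ) : (f ^ i).intDegree = i * f.intDegree := by
    induction i with
    | zero => simp
    | succ i ih => rw [pow_succ, RatFunc.intDegree_mul (pow_ne_zero _ hf) hf, ih]; push_cast; ring
  have hXm : (RatFunc.X ^ m : RatFunc k).intDegree = m := by
    obtain ⟨j, rfl | rfl⟩ := m.eq_nat_or_neg
    · rw [zpow_natCast, pow_deg _ hX, RatFunc.intDegree_X, mul_one]
    · rw [zpow_neg, RatFunc.intDegree_inv, zpow_natCast, pow_deg _ hX, RatFunc.intDegree_X, mul_one]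
  rcases Nat.eq_zero_or_pos r with rfl | hr
  · have := congrArg RatFunc.intDegree h
    rw [RatFunc.intDegree_mul hC (zpow_ne_zero _ hX), RatFunc.intDegree_C, hXm] at this
    simp at this
    simp [← this]
  · have hg : g ≠ 0 := by
      rintro rfl
      rw [zero_pow hr.ne'] at h
      exact mul_ne_zero hC (zpow_ne_zero _ hX) h.symm
    have := congrArg RatFunc.intDegree h
    rw [RatFunc.intDegree_mul hC (zpow_ne_zero _ hX), RatFunc.intDegree_C, hXm, pow_deg _ hg] at this
    exact ⟨_, by linarith⟩

/-- An Eisenstein argument at X = 0: a root is integral over k[X], hence a polynomial, and it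
vanishes at 0. Cancelling one factor X from the equation leaves 1 = 0 at the origin. -/
theorem ratFunc_quadratic_ne_zero {s n : k} (hn : n ≠ 0) (z : RatFunc k) :
    RatFunc.C n * z ^ 2 - RatFunc.X * (RatFunc.C s - RatFunc.X) * z + RatFunc.X ≠ 0 := by
  intro h
  have hz : IsIntegral k[X] z := by
    refine ⟨X ^ 2 + (C (C n⁻¹ * (X * (X - C s))) * X + C (C n⁻¹ * X)),
      monic_X_pow_add (degree_linear_lt.trans_le le_rfl), ?_⟩
    have hC : RatFunc.C n⁻¹ * RatFunc.C n = 1 := by rw [← map_mul, inv_mul_cancel₀ hn, map_one]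
    simp only [eval₂_add, eval₂_pow, eval₂_X, eval₂_mul, eval₂_C, eval₂_sub, map_mul, map_sub,
      RatFunc.algebraMap_C, RatFunc.algebraMap_X]
    linear_combination RatFunc.C n⁻¹ * h - z ^ 2 * hC
  obtain ⟨q, rfl⟩ := IsIntegrallyClosed.isIntegral_iff.mp hz
  have hq : C n * q ^ 2 - X * (C s - X) * q + X = 0 := by
    apply RatFunc.algebraMap_injective k
    simpa using h
  have h0 : q.eval 0 = 0 := by
    have := congrArg (eval 0) hq
    simpa [hn] using this
  obtain ⟨p, rfl⟩ : X ∣ q := X_dvd_iff.mpr (by rwa [coeff_zero_eq_eval_zero])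
  have hp : C n * X * p ^ 2 - X * (C s - X) * p + 1 = 0 := by
    apply mul_left_cancel₀ (X_ne_zero (R := k))
    linear_combination hq
  simpa using congrArg (eval 0) hp

/-- This stands in for the fact that a smooth Hesse cubic is not rational. A root is integral over
k[X], and degrees force it to be aX + b. Comparing coefficients then gives na³ = nb³ = -1 and s =
3nab, whence s³ = 27n. -/
theorem ratFunc_hesse_ne_zero {s n : k} (hn : n ≠ 0) (hsn : s ^ 3 ≠ 27 * n) (w : RatFunc k) :
    RatFunc.C n * w ^ 3 - RatFunc.C s * RatFunc.X * w + 1 + RatFunc.X ^ 3 ≠ 0 := by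
  intro h
  have hw : IsIntegral k[X] w := by
    refine ⟨X ^ 3 + (C (C n⁻¹ * (-(C s * X))) * X + C (C n⁻¹ * (1 + X ^ 3))),
      monic_X_pow_add (degree_linear_le.trans_lt (by norm_num)), ?_⟩
    have hC : RatFunc.C n⁻¹ * RatFunc.C n = 1 := by rw [← map_mul, inv_mul_cancel₀ hn, map_one]
    simp only [eval₂_add, eval₂_pow, eval₂_X, eval₂_mul, eval₂_C, eval₂_neg, eval₂_one, map_mul, map_neg,
      map_add, map_one, map_pow, RatFunc.algebraMap_C, RatFunc.algebraMap_X]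
    linear_combination RatFunc.C n⁻¹ * h - w ^ 3 * hC
  obtain ⟨q, rfl⟩ := IsIntegrallyClosed.isIntegral_iff.mp hw
  have hq : C n * q ^ 3 - C s * X * q + 1 + X ^ 3 = 0 := by
    apply RatFunc.algebraMap_injective k
    simpa using h
  have hdeg : q.natDegree ≤ 1 := by
    by_contra! hd
    have e : C n * q ^ 3 = C s * X * q - (1 + X ^ 3) := by linear_combination hq
    have h1 : (C n * q ^ 3).natDegree = 3 * q.natDegree := by
      rw [natDegree_C_mul hn, natDegree_pow]
    have h2 : (C s * X * q - (1 + X ^ 3)).natDegree ≤ max (1 + q.natDegree) 3 := by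
      refine (natDegree_sub_le _ _).trans (max_le_max ?_ (by compute_degree))
      exact natDegree_mul_le.trans (by gcongr; compute_degree)
    rw [← e, h1] at h2
    rcases le_max_iff.mp h2 with h2 | h2 <;> omega
  obtain ⟨a, b, rfl⟩ := exists_eq_X_add_C_of_natDegree_le_one hdeg
  have key : (⟨n * a ^ 3 + 1, 3 * n * a ^ 2 * b - s * a, 3 * n * a * b ^ 2 - s * b,
      n * b ^ 3 + 1⟩ : Cubic k).toPoly = (0 : Cubic k).toPoly := by
    simp only [Cubic.toPoly, map_add, map_mul, map_sub, map_pow, map_one, C_ofNat]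
    change _ = C 0 * X ^ 3 + C 0 * X ^ 2 + C 0 * X + C 0
    rw [C_0]
    linear_combination hq
  have key := (Cubic.toPoly_injective _ _).mp key
  have c0 := congrArg Cubic.d key
  have c2 := congrArg Cubic.b key
  have c3 := congrArg Cubic.a key
  change n * b ^ 3 + 1 = 0 at c0
  change 3 * n * a ^ 2 * b - s * a = 0 at c2
  change n * a ^ 3 + 1 = 0 at c3
  have ha : a ≠ 0 := by rintro rfl; simp at c3
  have hs : s = 3 * n * a * b := mul_right_cancel₀ ha (by linear_combination -c2)
  apply hsn
  rw [hs]
  linear_combination 27 * n * ((n * a ^ 3) * c0 - c3)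

variable {K : Type*} [Field K] [Algebra k K]

theorem exists_ratFunc_embedding {T : K} (hT : Transcendental k T) :
    ∃ ι : RatFunc k →ₐ[k] K, ι RatFunc.X = T ∧ ∀ z ∈ k⟮T⟯, ∃ w, ι w = z := by
  refine ⟨k⟮T⟯.val.comp (RatFunc.algEquivOfTranscendental T hT).toAlgHom, by simp, fun z hz =>
    ⟨(RatFunc.algEquivOfTranscendental T hT).symm ⟨z, hz⟩, by simp⟩⟩

theorem dvd_of_pow_eq_mul_zpow {T : K} (hT : Transcendental k T) {c : k} (hc : c ≠ 0) {m : ℤ}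
    {r : ℕ} {g : K} (hg : g ∈ k⟮T⟯) (h : g ^ r = algebraMap k K c * T ^ m) : (r : ℤ) ∣ m := by
  obtain ⟨ι, rfl, hι⟩ := exists_ratFunc_embedding hT
  obtain ⟨w, rfl⟩ := hι g hg
  refine dvd_of_ratFunc_pow_eq hc (g := w) (ι.toRingHom.injective ?_)
  change ι (w ^ r) = ι (RatFunc.C c * RatFunc.X ^ m)
  rw [map_pow, h, map_mul, map_zpow₀, ← RatFunc.algebraMap_eq_C, ι.commutes]

/-- The norm of the monomial `x ^ b₁ * y ^ b₂` to `k(x)`, on the curve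
`x + y + z = s`, `x * y * z = n`. -/
theorem dvd_of_pow_eq_monomial {s n : k} (hn : n ≠ 0) {x y z : K}
    (hs : x + y + z = algebraMap k K s) (hxyz : x * y * z = algebraMap k K n)
    (hx : Transcendental k x) (htop : k⟮x, y⟯ = ⊤) {b₁ b₂ : ℤ} {r : ℕ} {g : K}
    (hg : g ^ r = x ^ b₁ * y ^ b₂) : (r : ℤ) ∣ 2 * b₁ - b₂ := by
  have hn' : algebraMap k K n ≠ 0 := by simpa using hn
  have hx0 : x ≠ 0 := by rintro rfl; simp at hxyz; exact hn' hxyz.symm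
  have hy0 : y ≠ 0 := by rintro rfl; simp at hxyz; exact hn' hxyz.symm
  set E := k⟮x⟯
  have hxE : x ∈ E := mem_adjoin_simple_self k x
  let x' : E := ⟨x, hxE⟩
  have hx'0 : x' ≠ 0 := fun h => hx0 (congrArg Subtype.val h)
  -- The equation for y over k(x) is xy² - x(s - x)y + n = 0. Its reversal, satisfied by y⁻¹, has
  -- constant leading coefficient n, so integrality over k[x] applies.
  let P : E[X] := X ^ 2 + (C (-(algebraMap k E n⁻¹ * x' * (algebraMap k E s - x'))) * X +
    C (algebraMap k E n⁻¹ * x'))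
  have hPm : P.Monic := monic_X_pow_add (degree_linear_lt.trans_le le_rfl)
  have hPd : P.natDegree = 2 := by
    apply natDegree_eq_of_degree_eq_some
    rw [degree_add_eq_left_of_degree_lt, degree_X_pow, Nat.cast_ofNat]
    · rw [degree_X_pow]; exact degree_linear_lt
  have hni : algebraMap k K n⁻¹ * algebraMap k K n = 1 := by
    rw [← map_mul, inv_mul_cancel₀ hn, map_one]
  have hPz : aeval y⁻¹ P = 0 := by
    have hyy : y * y⁻¹ = 1 := mul_inv_cancel₀ hy0
    simp only [P, map_add, map_mul, map_pow, aeval_X, aeval_C, map_neg, map_sub]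
    change y⁻¹ ^ 2 + (-(algebraMap k K n⁻¹ * x * (algebraMap k K s - x)) * y⁻¹ +
      algebraMap k K n⁻¹ * x) = 0
    rw [← hs]
    have e : algebraMap k K n⁻¹ * (x * y * z) = 1 := by rw [hxyz, hni]
    linear_combination (-(y⁻¹ ^ 2)) * e + algebraMap k K n⁻¹ * x * (z * y⁻¹ - 1) * hyy
  have hPi : Irreducible P := by
    rw [hPm.irreducible_iff_roots_eq_zero_of_degree_le_three (by omega) (by omega)]
    rw [Multiset.eq_zero_iff_forall_notMem]
    intro t ht
    rw [mem_roots hPm.ne_zero, IsRoot.def] at ht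
    obtain ⟨ι, hιx, hι⟩ := exists_ratFunc_embedding hx
    obtain ⟨w, hw⟩ := hι t t.2
    refine ratFunc_quadratic_ne_zero (s := s) hn w (ι.toRingHom.injective ?_)
    have ht' := congrArg (algebraMap E K) ht
    simp [P] at ht'
    change ι _ = ι 0
    simp only [map_add, map_mul, map_sub, map_pow, ← RatFunc.algebraMap_eq_C, ι.commutes, hιx, hw,
      map_zero]
    change (t : K) ^ 2 + (-((algebraMap k K n)⁻¹ * x * (algebraMap k K s - x) * t) +
      (algebraMap k K n)⁻¹ * x) = 0 at ht'
    have e : algebraMap k K n * (algebraMap k K n)⁻¹ = 1 := mul_inv_cancel₀ hn'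
    linear_combination algebraMap k K n * ht' + (x * (algebraMap k K s - x) * t - x) * e
  have hmin : minpoly E y⁻¹ = P := (minpoly.eq_of_irreducible_of_monic hPi hPz hPm).symm
  have hint : IsIntegral E y⁻¹ := ⟨P, hPm, hPz⟩
  have hadj : Algebra.adjoin E {y⁻¹} = ⊤ := by
    rw [← adjoin_simple_toSubalgebra_of_isAlgebraic hint.isAlgebraic]
    have : E⟮y⁻¹⟯ = ⊤ := by
      apply restrictScalars_injective k
      rw [restrictScalars_top, eq_top_iff, ← htop, adjoin_le_iff]
      refine Set.insert_subset_iff.mpr ⟨E⟮y⁻¹⟯.algebraMap_mem x', Set.singleton_subset_iff.mpr ?_⟩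
      have := inv_mem (mem_adjoin_simple_self E y⁻¹)
      rwa [inv_inv] at this
    rw [this, top_toSubalgebra]
  let pb := PowerBasis.ofAdjoinEqTop hint hadj
  have hgen : pb.gen = y⁻¹ := PowerBasis.ofAdjoinEqTop_gen hint hadj
  have hdim : pb.dim = 2 := by rw [← pb.natDegree_minpoly, hgen, hmin, hPd]
  have hny : Algebra.norm E y⁻¹ = algebraMap k E n⁻¹ * x' := by
    rw [← hgen, Algebra.PowerBasis.norm_gen_eq_coeff_zero_minpoly, hgen, hmin, hdim]
    simp [P]
  have hnx : Algebra.norm E x = x' ^ 2 := by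
    rw [← hdim, ← pb.finrank]
    exact Algebra.norm_algebraMap x'
  have : Module.Finite E K := pb.finite
  let N : K →*₀ E := { Algebra.norm E with map_zero' := Algebra.norm_zero }
  replace hny : N y⁻¹ = algebraMap k E n⁻¹ * x' := hny
  replace hnx : N x = x' ^ 2 := hnx
  -- From N(y⁻¹) = x/n and N(x) = x², the norm of the monomial is a constant times x^(2b₁ - b₂).
  have hng : N g ^ r = algebraMap k E n ^ b₂ * x' ^ (2 * b₁ - b₂) := by
    have e : x ^ b₁ * y ^ b₂ = x ^ b₁ * y⁻¹ ^ (-b₂) := by rw [inv_zpow', neg_neg]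
    rw [← map_pow, hg, e, map_mul, map_zpow₀, map_zpow₀, hny, hnx, mul_zpow, zpow_sub₀ hx'0,
      zpow_mul, zpow_neg, zpow_neg, map_inv₀, inv_zpow, inv_inv, zpow_ofNat]
    ring
  refine dvd_of_pow_eq_mul_zpow hx (zpow_ne_zero b₂ hn) (N g).2 ?_
  have := congrArg (algebraMap E K) hng
  rw [map_mul, map_zpow₀, map_zpow₀, map_pow] at this
  rw [map_zpow₀]
  exact this

theorem mem_range_of_isAlgebraic [IsAlgClosed k] {c : K} (hc : IsAlgebraic k c) :
    ∃ a : k, algebraMap k K a = c :=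
  minpoly.mem_range_of_degree_eq_one k c <|
    IsAlgClosed.degree_eq_one_of_irreducible k (minpoly.irreducible hc.isIntegral)

/-- On a smooth curve `x + y + z = s`, `x * y * z = n` the function `x / y` is not a cube. -/
theorem cube_ne_div [IsAlgClosed k] {s n : k} (hn : n ≠ 0) (hsn : s ^ 3 ≠ 27 * n) {x y z : K}
    (hs : x + y + z = algebraMap k K s) (hxyz : x * y * z = algebraMap k K n)
    (hx : Transcendental k x) (htop : k⟮x, y⟯ = ⊤) (h : K) : h ^ 3 ≠ x / y := by
  intro hh
  have hn' : algebraMap k K n ≠ 0 := by simpa using hn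
  have hx0 : x ≠ 0 := by rintro rfl; simp at hxyz; exact hn' hxyz.symm
  have hy0 : y ≠ 0 := by rintro rfl; simp at hxyz; exact hn' hxyz.symm
  set u := h ^ 3 with hu
  have hxu : x = u * y := by rw [hh, div_mul_cancel₀ x hy0]
  have hyy : y * y⁻¹ = 1 := mul_inv_cancel₀ hy0
  -- With u = x/y, eliminating x and z shows that y⁻¹ has degree at most 3 over k(u).
  have hc : algebraMap k K n * y⁻¹ ^ 3 - algebraMap k K s * u * y⁻¹ + u * (1 + u) = 0 := by
    rw [← hs, ← hxyz, hxu]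
    field_simp
    ring
  have hut : Transcendental k u := by
    intro hua
    obtain ⟨c, hcu⟩ := mem_range_of_isAlgebraic hua
    have hva : IsAlgebraic k y⁻¹ := by
      refine ⟨C n * X ^ 3 - C (s * c) * X + C (c * (1 + c)), fun h0 => hn ?_, ?_⟩
      · simpa [coeff_X, coeff_C, coeff_one] using congrArg (coeff · 3) h0
      · simpa [hcu] using hc
    exact hx (hxu ▸ hua.mul (inv_inv y ▸ hva.inv))
  have hht : Transcendental k h := fun ha => hut (ha.pow 3)
  set E := k⟮u⟯
  have huE : u ∈ E := mem_adjoin_simple_self k u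
  let u' : E := ⟨u, huE⟩
  have hirr : Irreducible (X ^ 3 - C u') := by
    refine X_pow_sub_C_irreducible_of_prime Nat.prime_three fun b hb => ?_
    have := dvd_of_pow_eq_mul_zpow hut one_ne_zero b.2 (m := 1) (r := 3)
      (by simpa using congrArg Subtype.val hb)
    omega
  have hmin : minpoly E h = X ^ 3 - C u' :=
    (minpoly.eq_of_irreducible_of_monic hirr
      (by simp only [map_sub, map_pow, aeval_X, aeval_C]; exact sub_self u)
      (monic_X_pow_sub_C _ three_ne_zero)).symm
  have hhint : IsIntegral E h := minpoly.ne_zero_iff.mp (hmin ▸ hirr.ne_zero)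
  let Q : E[X] := X ^ 3 + (C (-(algebraMap k E n⁻¹ * algebraMap k E s * u')) * X +
    C (algebraMap k E n⁻¹ * (u' * (1 + u'))))
  have hQm : Q.Monic := monic_X_pow_add (degree_linear_le.trans_lt (by norm_num))
  have hQd : Q.natDegree = 3 := by
    apply natDegree_eq_of_degree_eq_some
    rw [degree_add_eq_left_of_degree_lt, degree_X_pow, Nat.cast_ofNat]
    rw [degree_X_pow]; exact degree_linear_le.trans_lt (by norm_num)
  have hQv : aeval y⁻¹ Q = 0 := by
    simp only [Q, map_add, map_mul, map_pow, aeval_X, aeval_C, map_neg]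
    have hni : algebraMap k K n⁻¹ * algebraMap k K n = 1 := by
      rw [← map_mul, inv_mul_cancel₀ hn, map_one]
    change y⁻¹ ^ 3 + (-(algebraMap k K n⁻¹ * algebraMap k K s * u) * y⁻¹ +
      algebraMap k K n⁻¹ * (u * (algebraMap E K 1 + u))) = 0
    rw [map_one]
    linear_combination algebraMap k K n⁻¹ * hc - y⁻¹ ^ 3 * hni
  have hvint : IsIntegral E y⁻¹ := ⟨Q, hQm, hQv⟩
  have hvtop : E⟮y⁻¹⟯ = ⊤ := by
    apply restrictScalars_injective k
    rw [restrictScalars_top, eq_top_iff, ← htop, adjoin_le_iff]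
    have hy : y ∈ E⟮y⁻¹⟯ := by
      have := inv_mem (mem_adjoin_simple_self E y⁻¹)
      rwa [inv_inv] at this
    refine Set.insert_subset_iff.mpr ⟨?_, Set.singleton_subset_iff.mpr hy⟩
    rw [hxu]
    exact mul_mem (E⟮y⁻¹⟯.algebraMap_mem u') hy
  have hfin : Module.Finite E K := by
    have := adjoin.finiteDimensional hvint
    rw [hvtop] at this
    exact Module.Finite.equiv topEquiv.toLinearEquiv
  have hle : Module.finrank E K ≤ 3 := by
    rw [← finrank_top', ← hvtop, adjoin.finrank hvint, ← hQd]
    exact natDegree_le_of_dvd (minpoly.dvd E _ hQv) hQm.ne_zero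
  -- The element h has degree exactly 3 over k(u), since u is not a cube there, while [K : k(u)] ≤
  -- 3. Hence K = k(h), and w = y⁻¹/h is a rational function of h solving the Hesse cubic.
  have hhtop : E⟮h⟯ = ⊤ := by
    refine eq_of_le_of_finrank_le le_top ?_
    rw [finrank_top', adjoin.finrank hhint, hmin, natDegree_X_pow_sub_C]
    exact hle
  have hktop : y⁻¹ ∈ k⟮h⟯ := by
    have e := congrArg (restrictScalars k) hhtop
    rw [adjoin_adjoin_left, restrictScalars_top] at e
    have : adjoin k ({u} ∪ {h}) ≤ k⟮h⟯ := by
      have hm := mem_adjoin_simple_self k h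
      rw [adjoin_le_iff]
      rintro _ (rfl | rfl)
      · exact pow_mem hm 3
      · exact hm
    exact this (e ▸ mem_top)
  have hh0 : h ≠ 0 := by rintro rfl; exact hht isAlgebraic_zero
  obtain ⟨ι, hιh, hι⟩ := exists_ratFunc_embedding hht
  obtain ⟨w, hw⟩ := hι (y⁻¹ / h) (div_mem hktop (mem_adjoin_simple_self k h))
  refine ratFunc_hesse_ne_zero hn hsn w (ι.toRingHom.injective ?_)
  change ι _ = ι 0
  simp only [map_add, map_mul, map_sub, map_pow, ← RatFunc.algebraMap_eq_C, ι.commutes, hιh, hw,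
    map_zero, map_one]
  apply mul_left_cancel₀ (pow_ne_zero 3 hh0)
  rw [mul_zero, ← hc, hu]
  field_simp
  ring

/-- The norms to k(x) and to k(y) give 2b₁ ≡ b₂ and 2b₂ ≡ b₁ modulo r, so r divides 3b₁. If r = 3
and 3 ∤ b₁, the monomial is a cube times x/y or y/x, which `cube_ne_div` excludes. -/
theorem prime_dvd_of_pow_eq_monomial [IsAlgClosed k] {s n : k} (hn : n ≠ 0)
    (hsn : s ^ 3 ≠ 27 * n) {x y z : K} (hs : x + y + z = algebraMap k K s)
    (hxyz : x * y * z = algebraMap k K n) (hx : Transcendental k x) (hy : Transcendental k y)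
    (htop : k⟮x, y⟯ = ⊤) {r : ℕ} (hr : r.Prime) {b₁ b₂ : ℤ} {g : K}
    (hg : g ^ r = x ^ b₁ * y ^ b₂) : (r : ℤ) ∣ b₁ ∧ (r : ℤ) ∣ b₂ := by
  have hn' : algebraMap k K n ≠ 0 := by simpa using hn
  have hx0 : x ≠ 0 := by rintro rfl; simp at hxyz; exact hn' hxyz.symm
  have hy0 : y ≠ 0 := by rintro rfl; simp at hxyz; exact hn' hxyz.symm
  have d₁ := dvd_of_pow_eq_monomial hn hs hxyz hx htop hg
  have d₂ : (r : ℤ) ∣ 2 * b₂ - b₁ := by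
    refine dvd_of_pow_eq_monomial hn (x := y) (y := x) (z := z) (by rw [← hs]; ring)
      (by rw [← hxyz]; ring) hy (by rw [Set.pair_comm]; exact htop) (g := g) ?_
    rw [hg, mul_comm]
  have d₃ : (r : ℤ) ∣ 3 * b₁ := by
    have := dvd_add (d₁.mul_left 2) d₂
    ring_nf at this ⊢
    exact this
  have hb₁ : (r : ℤ) ∣ b₁ := by
    rcases Int.Prime.dvd_mul' hr d₃ with h | h
    · have : r = 3 := (Nat.prime_dvd_prime_iff_eq hr Nat.prime_three).mp (by exact_mod_cast h)
      subst this
      by_contra hb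
      obtain ⟨j, hj⟩ := d₁
      obtain rfl : b₂ = 2 * b₁ - 3 * j := by push_cast at hj; linarith
      have h12 : b₁ % 3 = 1 ∨ b₁ % 3 = 2 := by omega
      rcases h12 with h1 | h1
      · obtain ⟨i, rfl⟩ : ∃ i, b₁ = 3 * i + 1 := ⟨b₁ / 3, by omega⟩
        refine cube_ne_div hn hsn hs hxyz hx htop (g * x ^ (-i) * y ^ (j - 2 * i - 1)) ?_
        have e : x ^ (3 * i + 1) * y ^ (2 * (3 * i + 1) - 3 * j) =
            (x ^ i) ^ 3 * (y ^ (2 * i + 1 - j)) ^ 3 * (x / y) := by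
          rw [← zpow_natCast, ← zpow_natCast, ← zpow_mul, ← zpow_mul, zpow_add₀ hx0, zpow_one,
            show 2 * (3 * i + 1) - 3 * j = (2 * i + 1 - j) * (3 : ℕ) - 1 by push_cast; ring,
            zpow_sub_one₀ hy0]
          push_cast
          ring_nf
        rw [mul_pow, mul_pow, hg, e, show j - 2 * i - 1 = -(2 * i + 1 - j) by ring, zpow_neg, zpow_neg]
        have := zpow_ne_zero i hx0
        have := zpow_ne_zero (2 * i + 1 - j) hy0
        field_simp
      · obtain ⟨i, rfl⟩ : ∃ i, b₁ = 3 * i + 2 := ⟨b₁ / 3, by omega⟩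
        refine cube_ne_div hn hsn hs hxyz hx htop (g⁻¹ * x ^ (i + 1) * y ^ (2 * i + 1 - j)) ?_
        have e : x ^ (3 * i + 2) * y ^ (2 * (3 * i + 2) - 3 * j) =
            (x ^ (i + 1)) ^ 3 * (y ^ (2 * i + 1 - j)) ^ 3 * (y / x) := by
          rw [← zpow_natCast, ← zpow_natCast, ← zpow_mul, ← zpow_mul,
            show 2 * (3 * i + 2) - 3 * j = (2 * i + 1 - j) * (3 : ℕ) + 1 by push_cast; ring,
            show 3 * i + 2 = (i + 1) * (3 : ℕ) - 1 by push_cast; ring,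
            zpow_add_one₀ hy0, zpow_sub_one₀ hx0]
          ring
        rw [mul_pow, mul_pow, inv_pow, hg, e]
        have := zpow_ne_zero (i + 1) hx0
        have := zpow_ne_zero (2 * i + 1 - j) hy0
        field_simp
    · exact h
  refine ⟨hb₁, ?_⟩
  have := dvd_sub (hb₁.mul_left 2) d₁
  rwa [sub_sub_cancel] at this

/-- Peel off one prime r of N at a time. After both exponents are divided by r, g^N differs from the
new monomial by an r-th root of unity. This lies in the algebraically closed constant field, so it
is an N-th power and can be absorbed into g. -/
theorem dvd_of_pow_eq_monomial_two [IsAlgClosed k] {s n : k} (hn : n ≠ 0)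
    (hsn : s ^ 3 ≠ 27 * n) {x y z : K} (hs : x + y + z = algebraMap k K s)
    (hxyz : x * y * z = algebraMap k K n) (hx : Transcendental k x) (hy : Transcendental k y)
    (htop : k⟮x, y⟯ = ⊤) (N : ℕ) (hN : N ≠ 0) {b₁ b₂ : ℤ} {g : K}
    (hg : g ^ N = x ^ b₁ * y ^ b₂) : (N : ℤ) ∣ b₁ ∧ (N : ℤ) ∣ b₂ := by
  have hn' : algebraMap k K n ≠ 0 := by simpa using hn
  have hx0 : x ≠ 0 := by rintro rfl; simp at hxyz; exact hn' hxyz.symm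
  have hy0 : y ≠ 0 := by rintro rfl; simp at hxyz; exact hn' hxyz.symm
  induction N using induction_on_primes generalizing b₁ b₂ g with
  | zero => exact absurd rfl hN
  | one => simp
  | prime_mul r N hr ih =>
    have hN' : N ≠ 0 := right_ne_zero_of_mul hN
    obtain ⟨⟨c₁, rfl⟩, ⟨c₂, rfl⟩⟩ := prime_dvd_of_pow_eq_monomial hn hsn hs hxyz hx hy htop hr
      (g := g ^ N) (by rw [← pow_mul, mul_comm N r, hg])
    have hM : x ^ c₁ * y ^ c₂ ≠ 0 := mul_ne_zero (zpow_ne_zero _ hx0) (zpow_ne_zero _ hy0)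
    have hζ : (g ^ N / (x ^ c₁ * y ^ c₂)) ^ r = 1 := by
      rw [div_pow, ← pow_mul, mul_comm N r, hg, mul_pow, ← zpow_natCast (x ^ c₁),
        ← zpow_natCast (y ^ c₂), ← zpow_mul, ← zpow_mul, mul_comm c₁, mul_comm c₂, div_self]
      exact mul_ne_zero (zpow_ne_zero _ hx0) (zpow_ne_zero _ hy0)
    obtain ⟨ζ, hζ'⟩ := mem_range_of_isAlgebraic (k := k)
      (IsAlgebraic.of_pow hr.pos (hζ ▸ isAlgebraic_one))
    obtain ⟨c, rfl⟩ := IsAlgClosed.exists_pow_nat_eq ζ (Nat.pos_of_ne_zero hN')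
    rw [eq_div_iff hM, map_pow] at hζ'
    have hc : algebraMap k K c ≠ 0 := by
      intro h0
      rw [h0, zero_pow hN', zero_mul, eq_comm] at hζ'
      have := pow_eq_zero_iff hN' |>.mp hζ'
      rw [this, zero_pow hN] at hg
      exact mul_ne_zero (zpow_ne_zero _ hx0) (zpow_ne_zero _ hy0) hg.symm
    obtain ⟨d₁, d₂⟩ := ih hN' (g := g / algebraMap k K c) (by
      rw [div_pow, ← hζ', mul_div_cancel_left₀ _ (pow_ne_zero _ hc)])
    push_cast
    exact ⟨mul_dvd_mul_left _ d₁, mul_dvd_mul_left _ d₂⟩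

/-- A monomial in the coordinates of a smooth curve `x₀ + x₁ + x₂ = s`, `x₀ * x₁ * x₂ = n` is an
`N`-th power in its function field only if its exponents agree modulo `N`. -/
theorem modEq_of_pow_eq_monomial [IsAlgClosed k] {s n : k} (hn : n ≠ 0)
    (hsn : s ^ 3 ≠ 27 * n) {x : Fin 3 → K} (hs : ∑ i, x i = algebraMap k K s)
    (hxyz : ∏ i, x i = algebraMap k K n) (hx : ∀ i, Transcendental k (x i))
    (htop : adjoin k (Set.range x) = ⊤) {N : ℕ} (hN : N ≠ 0) {a : Fin 3 → ℤ} {g : K}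
    (hg : g ^ N = ∏ i, x i ^ a i) (i j : Fin 3) : a i ≡ a j [ZMOD N] := by
  rw [Fin.sum_univ_three] at hs
  rw [Fin.prod_univ_three] at hxyz hg
  have hn' : algebraMap k K n ≠ 0 := by simpa using hn
  have h0 (i) : x i ≠ 0 := fun h => hx i (h ▸ isAlgebraic_zero)
  have htop' : k⟮x 0, x 1⟯ = ⊤ := by
    rw [eq_top_iff, ← htop, adjoin_le_iff]
    have m0 : x 0 ∈ k⟮x 0, x 1⟯ := subset_adjoin _ _ (by simp)
    have m1 : x 1 ∈ k⟮x 0, x 1⟯ := subset_adjoin _ _ (by simp)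
    rintro _ ⟨i, rfl⟩
    fin_cases i
    · exact m0
    · exact m1
    · have : x 2 = algebraMap k K s - x 0 - x 1 := by rw [← hs]; ring
      change x 2 ∈ _
      rw [this]
      exact sub_mem (sub_mem (IntermediateField.algebraMap_mem _ _) m0) m1
  -- Eliminating x₂ = n/(x₀x₁) produces the constant n^(a₂), which c removes inside the N-th power.
  obtain ⟨c, hc⟩ := IsAlgClosed.exists_pow_nat_eq (n ^ (-a 2)) (Nat.pos_of_ne_zero hN)
  have hz : x 2 = algebraMap k K n * (x 0)⁻¹ * (x 1)⁻¹ := by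
    rw [← hxyz]
    have := h0 0
    have := h0 1
    field_simp
  obtain ⟨d₀, d₁⟩ := dvd_of_pow_eq_monomial_two hn hsn hs hxyz (hx 0) (hx 1) htop' N hN
    (b₁ := a 0 - a 2) (b₂ := a 1 - a 2) (g := g * algebraMap k K c) (by
      rw [mul_pow, hg, ← map_pow, hc, hz, mul_zpow, mul_zpow, zpow_sub₀ (h0 0), zpow_sub₀ (h0 1),
        inv_zpow, inv_zpow, map_zpow₀, zpow_neg]
      have := zpow_ne_zero (a 2) hn'
      field_simp)
  have h02 : a 2 ≡ a 0 [ZMOD N] := Int.modEq_iff_dvd.mpr d₀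
  have h12 : a 2 ≡ a 1 [ZMOD N] := Int.modEq_iff_dvd.mpr d₁
  have key (i) : a 2 ≡ a i [ZMOD N] := by
    fin_cases i
    exacts [h02, h12, Int.ModEq.refl _]
  exact (key i).symm.trans (key j)

end FunctionField

/-! ### The split curve: irreducibility, coordinate ring and function field. -/

section SplitCurve

open Polynomial

variable {k : Type*} [Field k]

/-- A nonzero element of an affine domain over an algebraically closed field is nonzero at some
point. -/
theorem exists_algHom_apply_ne_zero [IsAlgClosed k] {A : Type*} [CommRing A] [IsDomain A]
    [Algebra k A] [Algebra.FiniteType k A] {a : A} (ha : a ≠ 0) : ∃ φ : A →ₐ[k] k, φ a ≠ 0 := by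
  let L := Localization.Away a
  have : Nontrivial L := (IsLocalization.injective L
    (powers_le_nonZeroDivisors_of_noZeroDivisors ha)).nontrivial
  have : Algebra.FiniteType A L := IsLocalization.finiteType_of_monoid_fg (Submonoid.powers a) L
  have : Algebra.FiniteType k L := Algebra.FiniteType.trans (S := A) inferInstance inferInstance
  obtain ⟨m, hm⟩ := Ideal.exists_maximal L
  let : Field (L ⧸ m) := Ideal.Quotient.field m
  have := finite_of_finite_type_of_isJacobsonRing k (L ⧸ m)
  let e : k ≃ₐ[k] L ⧸ m := AlgEquiv.ofBijective (Algebra.ofId k (L ⧸ m))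
    IsAlgClosed.algebraMap_bijective_of_isIntegral
  let φ : L →ₐ[k] k := (e.symm : L ⧸ m →ₐ[k] k).comp (Ideal.Quotient.mkₐ k m)
  refine ⟨φ.comp (IsScalarTower.toAlgHom k A L), ?_⟩
  exact ((IsLocalization.Away.algebraMap_isUnit (S := L) a).map φ).ne_zero

/-- The equation of the curve `x + y + z = s`, `x * y * z = n` in the plane. -/
noncomputable def planeEquation (s n : k) : k[X][X] := C X * X ^ 2 - C (X * (C s - X)) * X + C (C n)

/-- The reversed polynomial nY² - X(s - X)Y + X is Eisenstein at X, and reversal turns a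
factorization of one into a factorization of the other. -/
theorem irreducible_planeEquation (s : k) {n : k} (hn : n ≠ 0) : Irreducible (planeEquation s n) := by
  let Q : k[X][X] := C (C n) * X ^ 2 + C (-(X * (C s - X))) * X + C X
  have hX : Prime (X : k[X]) := prime_X
  have hCn : C n ≠ 0 := by simpa using hn
  have hQd : Q.natDegree = 2 := natDegree_quadratic hCn
  have hQ0 : Q.coeff 0 = X := by simp [Q]
  have hQ1 : Q.coeff 1 = -(X * (C s - X)) := by simp [Q, coeff_C]
  have hQ2 : Q.coeff 2 = C n := by simp [Q]
  have hQ : Irreducible Q := by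
    refine irreducible_of_eisenstein_criterion (P := Ideal.span {X})
      ((Ideal.span_singleton_prime X_ne_zero).mpr hX) ?_ ?_ ?_ ?_ ?_
    · rw [leadingCoeff, hQd, hQ2, Ideal.mem_span_singleton, X_dvd_iff]
      simpa using hn
    · intro i hi
      rw [degree_eq_natDegree (fun h => by simp [h] at hQd), hQd] at hi
      have hi : i < 2 := by exact_mod_cast hi
      rw [Ideal.mem_span_singleton]
      interval_cases i
      · rw [hQ0]
      · rw [hQ1]; exact (dvd_mul_right _ _).neg_right
    · exact natDegree_pos_iff_degree_pos.mp (by omega)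
    · rw [hQ0, Ideal.span_singleton_pow, Ideal.mem_span_singleton]
      intro h
      have := natDegree_le_of_dvd h X_ne_zero
      simp at this
    · intro r hr
      rw [C_dvd_iff_dvd_coeff] at hr
      exact isUnit_of_dvd_unit (hQ2 ▸ hr 2) (isUnit_C.mpr hn.isUnit)
  have hPQ : reflect 2 (planeEquation s n) = Q := by
    have e : planeEquation s n = C X * X ^ 2 + C (-(X * (C s - X))) * X ^ 1 + C (C n) * X ^ 0 := by
      simp only [planeEquation, map_neg]; ring
    rw [e, reflect_add, reflect_add, reflect_C_mul_X_pow, reflect_C_mul_X_pow, reflect_C_mul_X_pow]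
    simp only [Q, revAt_le le_rfl, revAt_le one_le_two, revAt_le zero_le_two]
    ring
  have hP0 : (planeEquation s n).coeff 0 = C n := by simp [planeEquation]
  have hPd : (planeEquation s n).natDegree = 2 := by
    have e : planeEquation s n = C X * X ^ 2 + C (-(X * (C s - X))) * X + C (C n) := by
      simp only [planeEquation, map_neg]; ring
    rw [e]
    exact natDegree_quadratic X_ne_zero
  have hPne : planeEquation s n ≠ 0 := fun h => by simp [h] at hPd
  -- Reversal can lose powers of the variable: a factor with unit reversal is a unit times a power
  -- of Y. A positive power is impossible because the constant term n is nonzero.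
  have unit_of (f g : k[X][X]) (hfg : planeEquation s n = f * g)
      (hf : IsUnit (reflect f.natDegree f)) : IsUnit f := by
    obtain ⟨c, hc, hcf⟩ := isUnit_iff.mp hf
    have e : f = reflect f.natDegree (C c) := by rw [hcf, reflect_reflect]
    rw [reflect_C] at e
    rcases Nat.eq_zero_or_pos f.natDegree with h0 | h0
    · rw [e, h0, pow_zero, mul_one]; exact isUnit_C.mpr hc
    · have : X ∣ planeEquation s n :=
        hfg ▸ e ▸ ((dvd_pow_self X h0.ne').mul_left _).mul_right _
      exact absurd (hP0 ▸ X_dvd_iff.mp this) hCn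
  refine ⟨fun h => by simp [natDegree_eq_zero_of_isUnit h] at hPd, fun f g hfg => ?_⟩
  have hf : f ≠ 0 := left_ne_zero_of_mul (hfg ▸ hPne)
  have hg : g ≠ 0 := right_ne_zero_of_mul (hfg ▸ hPne)
  have hd : f.natDegree + g.natDegree = 2 := by rw [← natDegree_mul hf hg, ← hfg, hPd]
  have h := reflect_mul f g le_rfl le_rfl
  rw [← hfg, hd, hPQ] at h
  rcases hQ.isUnit_or_isUnit h with hu | hu
  · exact Or.inl (unit_of f g hfg hu)
  · exact Or.inr (unit_of g f (by rw [hfg, mul_comm]) hu)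

variable {C₀ : Type*}

/-- The algebra of functions generated by finitely many coordinates. -/
def coordinateRing {ι : Type*} (c : C₀ → ι → k) : Subalgebra k (C₀ → k) :=
  Algebra.adjoin k (Set.range fun i x => c x i)

/-- `c` are coordinates on `C₀` whose values are the solutions of `∑ x = s`, `∏ x = n`. -/
structure IsTraceNormCurve (s n : k) (c : C₀ → Fin 3 → k) : Prop where
  sum_eq : ∀ x, ∑ i, c x i = s
  prod_eq : ∀ x, ∏ i, c x i = n
  exists_eq : ∀ v : Fin 3 → k, ∑ i, v i = s → ∏ i, v i = n → ∃ x, c x = v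

variable {s n : k} {c : C₀ → Fin 3 → k}

/-- The coordinate functions. -/
def coordinate {ι : Type*} (c : C₀ → ι → k) (i : ι) : coordinateRing c :=
  ⟨fun x => c x i, Algebra.subset_adjoin ⟨i, rfl⟩⟩

/-- Every k-point of the domain k[x][y]/(equation) comes from a point of the curve, so by the
Nullstellensatz this domain embeds into the functions on `C₀`. The image contains the coordinate
functions. -/
theorem IsTraceNormCurve.isDomain [IsAlgClosed k] (hn : n ≠ 0) (hc : IsTraceNormCurve s n c) :
    IsDomain (coordinateRing c) := by
  have hP := irreducible_planeEquation s hn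
  let A := AdjoinRoot (planeEquation s n)
  have : IsDomain A := AdjoinRoot.isDomain_of_prime hP.prime
  have : Algebra.FiniteType k A := inferInstance
  have hroot (x : C₀) : (planeEquation s n).eval₂ (aeval (c x 0) : k[X] →ₐ[k] k) (c x 1) = 0 := by
    have h1 := hc.sum_eq x
    have h2 := hc.prod_eq x
    rw [Fin.sum_univ_three] at h1
    rw [Fin.prod_univ_three] at h2
    simp [planeEquation, eval₂_sub]
    rw [← h1, ← h2]
    ring
  let Φ : A →ₐ[k] (C₀ → k) := AlgHom.pi fun x => AdjoinRoot.liftAlgHom _ (aeval (c x 0)) (c x 1)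
    (hroot x)
  let x₀ : A := AdjoinRoot.of _ X
  let x₁ : A := AdjoinRoot.root _
  let x₂ : A := algebraMap k A s - x₀ - x₁
  have hΦ₀ : Φ x₀ = fun x => c x 0 := by ext x; exact (AdjoinRoot.liftAlgHom_of _ _ _ (hroot x) X).trans (aeval_X _)
  have hΦ₁ : Φ x₁ = fun x => c x 1 := by ext x; exact AdjoinRoot.liftAlgHom_root _ _ _ (hroot x)
  have hΦ₂ : Φ x₂ = fun x => c x 2 := by
    ext x
    rw [map_sub, map_sub, hΦ₀, hΦ₁, AlgHom.commutes]
    have := hc.sum_eq x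
    rw [Fin.sum_univ_three] at this
    simp only [← this, Pi.sub_apply, Pi.algebraMap_apply, Algebra.algebraMap_self, RingHom.id_apply]
    ring
  have hprod : x₀ * x₁ * x₂ = algebraMap k A n := by
    have e : planeEquation s n = C (C n) - C X * X * (C (C s) - C X - X) := by
      simp only [planeEquation, map_mul, map_sub]; ring
    have h0 : AdjoinRoot.mk (planeEquation s n)
        (C (C n) - C X * X * (C (C s) - C X - X)) = 0 := by
      rw [← e]; exact AdjoinRoot.mk_self
    rw [map_sub, sub_eq_zero, map_mul, map_mul, map_sub, map_sub] at h0
    exact h0.symm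
  have hinj : Function.Injective Φ := by
    rw [injective_iff_map_eq_zero]
    intro a ha
    by_contra ha0
    obtain ⟨φ, hφ⟩ := exists_algHom_apply_ne_zero (k := k) ha0
    obtain ⟨x, hx⟩ := hc.exists_eq ![φ x₀, φ x₁, φ x₂]
      (by simp [Fin.sum_univ_three, x₂]) (by simp [Fin.prod_univ_three, ← map_mul, hprod])
    have : φ = (Pi.evalAlgHom k (fun _ : C₀ => k) x).comp Φ := by
      refine AdjoinRoot.algHom_ext' (Polynomial.algHom_ext ?_) ?_
      · change φ x₀ = Φ x₀ x
        rw [hΦ₀]; exact (congrFun hx 0).symm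
      · change φ x₁ = Φ x₁ x
        rw [hΦ₁]; exact (congrFun hx 1).symm
    apply hφ
    rw [this]
    exact congrFun ha x
  have hle : coordinateRing c ≤ Φ.range := by
    rw [coordinateRing, Algebra.adjoin_le_iff]
    rintro _ ⟨i, rfl⟩
    fin_cases i
    exacts [⟨_, hΦ₀⟩, ⟨_, hΦ₁⟩, ⟨_, hΦ₂⟩]
  have : IsDomain Φ.range := (AlgEquiv.ofInjective Φ hinj).toMulEquiv.symm.isDomain A
  exact (Subalgebra.inclusion_injective hle).isDomain (Subalgebra.inclusion hle).toRingHom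

/-- One coordinate may be any nonzero t: the other two are the roots of Y² + (t - s)Y + n/t. -/
theorem exists_sum_eq_prod_eq [IsAlgClosed k] (s n : k) {t : k} (ht : t ≠ 0) (i : Fin 3) :
    ∃ v : Fin 3 → k, v i = t ∧ ∑ j, v j = s ∧ ∏ j, v j = n := by
  let Q : k[X] := C 1 * X ^ 2 + C (t - s) * X + C (n / t)
  obtain ⟨y, hy⟩ := IsAlgClosed.exists_root Q (by
    rw [degree_quadratic one_ne_zero]; decide)
  have hy : y ^ 2 + (t - s) * y + n / t = 0 := by simpa [Q, IsRoot] using hy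
  have h1 : t + y + (s - t - y) = s := by ring
  have h2 : t * y * (s - t - y) = n := by
    field_simp at hy
    linear_combination -hy
  fin_cases i
  · exact ⟨![t, y, s - t - y], rfl, by simp [Fin.sum_univ_three],
      by simpa [Fin.prod_univ_three] using h2⟩
  · exact ⟨![y, t, s - t - y], rfl, by simp only [Fin.sum_univ_three, Matrix.cons_val]; ring,
      by rw [← h2]; simp only [Fin.prod_univ_three, Matrix.cons_val]; ring⟩
  · exact ⟨![y, s - t - y, t], rfl, by simp only [Fin.sum_univ_three, Matrix.cons_val]; ring,
      by rw [← h2]; simp only [Fin.prod_univ_three, Matrix.cons_val]; ring⟩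

variable {K : Type*} [Field K] [Algebra k K] [Algebra (coordinateRing c) K]
  [IsScalarTower k (coordinateRing c) K] [IsFractionRing (coordinateRing c) K]

/-- Each coordinate takes every nonzero value, so a polynomial relation would have infinitely many
roots. -/
theorem IsTraceNormCurve.transcendental [IsAlgClosed k] (hc : IsTraceNormCurve s n c)
    (i : Fin 3) : Transcendental k (algebraMap (coordinateRing c) K (coordinate c i)) := by
  rintro ⟨p, hp, hpx⟩
  rw [aeval_algebraMap_apply, map_eq_zero_iff _ (IsFractionRing.injective (coordinateRing c) K)] at hpx
  have hroot (t : k) (ht : t ≠ 0) : p.IsRoot t := by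
    obtain ⟨v, hv, h1, h2⟩ := exists_sum_eq_prod_eq s n ht i
    obtain ⟨x, hx⟩ := hc.exists_eq v h1 h2
    have := congrArg ((Pi.evalAlgHom k (fun _ : C₀ => k) x).comp (coordinateRing c).val) hpx
    rw [← aeval_algHom_apply, map_zero] at this
    change aeval (c x i) p = 0 at this
    rwa [hx, hv] at this
  apply hp
  apply eq_zero_of_infinite_isRoot
  refine Set.Infinite.mono (s := {0}ᶜ) (fun t ht => hroot t ht) ?_
  exact (Set.finite_singleton 0).infinite_compl

theorem adjoin_coordinate_eq_top :
    IntermediateField.adjoin k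
      (Set.range fun i => algebraMap (coordinateRing c) K (coordinate c i)) = ⊤ := by
  rw [eq_top_iff]
  rintro z -
  obtain ⟨a, b, -, rfl⟩ := IsFractionRing.div_surjective (A := coordinateRing c) z
  have key (a : coordinateRing c) : algebraMap (coordinateRing c) K a ∈ IntermediateField.adjoin k
      (Set.range fun i => algebraMap (coordinateRing c) K (coordinate c i)) := by
    obtain ⟨a, ha⟩ := a
    induction ha using Algebra.adjoin_induction with
    | mem x hx =>
      obtain ⟨i, rfl⟩ := hx
      exact IntermediateField.subset_adjoin _ _ ⟨i, rfl⟩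
    | algebraMap r =>
      have := IntermediateField.algebraMap_mem (IntermediateField.adjoin k
        (Set.range fun i => algebraMap (coordinateRing c) K (coordinate c i))) r
      rwa [IsScalarTower.algebraMap_apply k (coordinateRing c) K] at this
    | add x y hx hy h1 h2 =>
      have := add_mem h1 h2
      rwa [← map_add] at this
    | mul x y hx hy h1 h2 =>
      have := mul_mem h1 h2
      rwa [← map_mul] at this
  exact div_mem (key a) (key b)

theorem IsTraceNormCurve.modEq_of_pow_eq [IsAlgClosed k] (hn : n ≠ 0) (hsn : s ^ 3 ≠ 27 * n)
    (hc : IsTraceNormCurve s n c) {N : ℕ} (hN : N ≠ 0) {a : Fin 3 → ℤ} {g : K}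
    (hg : g ^ N = ∏ i, algebraMap (coordinateRing c) K (coordinate c i) ^ a i) (i j : Fin 3) :
    a i ≡ a j [ZMOD N] := by
  refine modEq_of_pow_eq_monomial hn hsn ?_ ?_ (fun i => hc.transcendental i)
    adjoin_coordinate_eq_top hN hg i j
  · rw [← map_sum, IsScalarTower.algebraMap_apply k (coordinateRing c) K]
    congr 1
    ext x
    simpa [coordinate] using hc.sum_eq x
  · rw [← map_prod, IsScalarTower.algebraMap_apply k (coordinateRing c) K]
    congr 1
    ext x
    simpa [coordinate] using hc.prod_eq x

end SplitCurve

/-! ### Kummer theory for several radicals. -/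

section Kummer

variable {k K Ω : Type*} [Field k] [IsAlgClosed k] [Field K] [Algebra k K] [Field Ω] [Algebra k Ω]
  [Algebra K Ω] [IsScalarTower k K Ω] [IsGalois K Ω]

/-- Kummer theory: multiplicatively independent radicals are permuted by all roots of unity. -/
theorem exists_galois_apply_eq_mul {ι : Type*} [Finite ι] {M : ℕ} (hM : (M : k) ≠ 0)
    {t : ι → Ω} (ht : ∀ i, t i ≠ 0) {x : ι → K} (htx : ∀ i, t i ^ M = algebraMap K Ω (x i))
    (hx : ∀ (b : ι → ℤ) (g : K), g ^ M = ∏ᶠ i, x i ^ b i → ∀ i, (M : ℤ) ∣ b i)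
    (ζ : ι → rootsOfUnity M k) :
    ∃ γ : Ω ≃ₐ[K] Ω, ∀ i, γ (t i) = algebraMap k Ω ((ζ i : kˣ) : k) * t i := by
  classical
  have := Fintype.ofFinite ι
  simp only [finprod_eq_prod_of_fintype] at hx
  have hM0 : M ≠ 0 := by rintro rfl; simp at hM
  have : NeZero M := ⟨hM0⟩
  have : NeZero (M : k) := ⟨hM⟩
  have γk (γ : Ω ≃ₐ[K] Ω) (a : k) : γ (algebraMap k Ω a) = algebraMap k Ω a := by
    rw [IsScalarTower.algebraMap_apply k K Ω, AlgEquiv.commutes]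
  -- H consists of the tuples realised by Galois. If ζ ∉ H, some character of the quotient by H is
  -- nontrivial on ζ. It will turn out to be trivial everywhere.
  let H : Subgroup (ι → rootsOfUnity M k) :=
    { carrier := {ζ | ∃ γ : Ω ≃ₐ[K] Ω, ∀ i, γ (t i) = algebraMap k Ω ((ζ i : kˣ) : k) * t i}
      one_mem' := ⟨AlgEquiv.refl, fun i => by simp⟩
      mul_mem' := by
        rintro ζ ξ ⟨γ, hγ⟩ ⟨δ, hδ⟩
        refine ⟨δ.trans γ, fun i => ?_⟩
        rw [AlgEquiv.trans_apply, hδ, map_mul, γk, hγ]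
        simp only [Pi.mul_apply, Subgroup.coe_mul, Units.val_mul, map_mul]
        ring
      inv_mem' := by
        rintro ζ ⟨γ, hγ⟩
        refine ⟨γ.symm, fun i => ?_⟩
        apply γ.injective
        rw [AlgEquiv.apply_symm_apply, map_mul, γk, hγ, ← mul_assoc, ← map_mul, ← Units.val_mul]
        simp }
  by_contra hζ
  have hζH : ζ ∉ H := hζ
  have hexp : Monoid.exponent ((ι → rootsOfUnity M k) ⧸ H) ∣ M := by
    refine Monoid.exponent_dvd_of_forall_pow_eq_one fun q => ?_
    obtain ⟨q, rfl⟩ := QuotientGroup.mk_surjective q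
    rw [← QuotientGroup.mk_pow]
    have : q ^ M = 1 := by ext i; simpa using congrArg Units.val (q i).2
    rw [this, QuotientGroup.mk_one]
  have := HasEnoughRootsOfUnity.of_dvd k hexp
  obtain ⟨φ, hφ⟩ := CommGroup.exists_apply_ne_one_of_hasEnoughRootsOfUnity
    ((ι → rootsOfUnity M k) ⧸ H) k (a := (ζ : (ι → rootsOfUnity M k) ⧸ H))
    (by rwa [Ne, QuotientGroup.eq_one_iff])
  let χ : (ι → rootsOfUnity M k) →* kˣ := φ.comp (QuotientGroup.mk' H)
  have hχH (ξ) (hξ : ξ ∈ H) : χ ξ = 1 := by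
    change φ (ξ : (ι → rootsOfUnity M k) ⧸ H) = 1
    rw [(QuotientGroup.eq_one_iff ξ).mpr hξ, map_one]
  have hχi (i : ι) : ∃ b : ℤ, ∀ u : rootsOfUnity M k, χ (Pi.mulSingle i u) = (u : kˣ) ^ b := by
    let σ : rootsOfUnity M k →* rootsOfUnity M k :=
      (χ.comp (MonoidHom.mulSingle (fun _ => rootsOfUnity M k) i)).codRestrict _ fun u => by
        rw [mem_rootsOfUnity, ← map_pow]
        have : u ^ M = 1 := Subtype.ext u.2
        rw [this, map_one]
    obtain ⟨b, hb⟩ := σ.map_cyclic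
    exact ⟨b, fun u => congrArg Subtype.val (hb u)⟩
  choose b hb using hχi
  have hχ (ξ : ι → rootsOfUnity M k) : χ ξ = ∏ i, (ξ i : kˣ) ^ b i := by
    conv_lhs => rw [← Finset.univ_prod_mulSingle ξ, map_prod]
    exact Finset.prod_congr rfl fun i _ => hb i _
  -- Galois multiplies ∏ tᵢ^bᵢ by a value of χ on H, which is 1. The product therefore lies in K,
  -- and independence gives M ∣ bᵢ, making χ trivial.
  have hfix : ∏ i, t i ^ b i ∈ Set.range (algebraMap K Ω) := by
    rw [InfiniteGalois.mem_range_algebraMap_iff_fixed]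
    intro γ
    have hγ (i : ι) : ∃ u : rootsOfUnity M k, γ (t i) = algebraMap k Ω ((u : kˣ) : k) * t i := by
      have h1 : (γ (t i) / t i) ^ M = 1 := by
        rw [div_pow, ← map_pow, htx, AlgEquiv.commutes, div_self]
        rw [← htx]; exact pow_ne_zero _ (ht i)
      obtain ⟨u, hu⟩ := mem_range_of_isAlgebraic (k := k)
        (IsAlgebraic.of_pow (Nat.pos_of_ne_zero hM0) (h1 ▸ isAlgebraic_one))
      have hu1 : u ^ M = 1 := by
        apply (algebraMap k Ω).injective
        rw [map_pow, hu, h1, map_one]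
      exact ⟨rootsOfUnity.mkOfPowEq u hu1, by
        rw [rootsOfUnity.coe_mkOfPowEq, hu, div_mul_cancel₀ _ (ht i)]⟩
    choose ξ hξ using hγ
    have h1 := hχH ξ ⟨γ, hξ⟩
    rw [hχ] at h1
    have h2 := congrArg (fun u : kˣ => algebraMap k Ω u) h1
    simp only [Units.coe_prod, Units.val_zpow_eq_zpow_val, map_prod, map_zpow₀, Units.val_one,
      map_one] at h2
    simp only [map_prod, map_zpow₀, hξ, mul_zpow, Finset.prod_mul_distrib, h2, one_mul]
  obtain ⟨g, hg⟩ := hfix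
  have hMb := hx b g (by
    apply (algebraMap K Ω).injective
    rw [map_pow, hg, map_prod, ← Finset.prod_pow]
    refine Finset.prod_congr rfl fun i _ => ?_
    rw [map_zpow₀, ← htx, ← zpow_natCast, ← zpow_natCast, ← zpow_mul, ← zpow_mul, mul_comm])
  apply hφ
  change χ ζ = 1
  rw [hχ]
  refine Finset.prod_eq_one fun i _ => ?_
  obtain ⟨j, hj⟩ := hMb i
  have : (ζ i : kˣ) ^ M = 1 := (ζ i).2
  rw [hj, zpow_mul, zpow_natCast, this, one_zpow]

end Kummer

/-! ### Locally constant functions and Zariski irreducibility. -/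

section Irreducible

variable {k : Type*} [Field k]

theorem regularFunctions_comp {X X' V : Type*} [AddCommGroup V] [Module k V] {i : X → V}
    {R : Subalgebra k (X' → k)} (g : X' → X)
    (h : ∀ l : Module.Dual k V, (fun x => l (i (g x))) ∈ R) {f : X → k}
    (hf : f ∈ regularFunctions k i) : (fun x => f (g x)) ∈ R := by
  induction hf using Algebra.adjoin_induction with
  | mem f hf => obtain ⟨l, rfl⟩ := hf; exact h l
  | algebraMap r => exact R.algebraMap_mem r
  | add f f' _ _ h h' => exact add_mem h h'
  | mul f f' _ _ h h' => exact mul_mem h h'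

/-- Locally constant functions are constant on the image of an irreducible affine variety. -/
theorem locallyConstant_eq_of_isDomain [IsAlgClosed k] {A : Type*} [CommRing A] [IsDomain A]
    [Algebra k A] [Algebra.FiniteType k A] {W V E : Type*} [AddCommGroup V] [Module k V] {i : W → V}
    (P : (A →ₐ[k] k) → W)
    (hP : ∀ f ∈ regularFunctions k i, ∃ a : A, ∀ φ, f (P φ) = φ a) {f : W → E}
    (hf : @IsLocallyConstant W E (zariskiTopology k i) f) (φ φ' : A →ₐ[k] k) :
    f (P φ) = f (P φ') := by
  let := zariskiTopology k i
  -- Around each point, the preimage of an open set contains a principal open subset of the space of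
  -- k-points of A. Two nonempty principal opens meet because A is a domain.
  have key (O : Set W) (hO : IsOpen O) (φ : A →ₐ[k] k) (hφ : P φ ∈ O) :
      ∃ a : A, φ a ≠ 0 ∧ ∀ φ' : A →ₐ[k] k, φ' a ≠ 0 → P φ' ∈ O := by
    induction hO with
    | basic O hO =>
      obtain ⟨f, hf, rfl⟩ := hO
      obtain ⟨a, ha⟩ := hP f hf
      exact ⟨a, ha φ ▸ hφ, fun φ' h => by rw [Set.mem_ofPred_eq, ha]; exact h⟩
    | univ => exact ⟨1, by simp, fun _ _ => trivial⟩
    | inter O O' _ _ h h' =>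
      obtain ⟨a, ha, haO⟩ := h hφ.1
      obtain ⟨b, hb, hbO⟩ := h' hφ.2
      refine ⟨a * b, by rw [map_mul]; exact mul_ne_zero ha hb, fun φ' h => ?_⟩
      rw [map_mul] at h
      exact ⟨haO φ' (left_ne_zero_of_mul h), hbO φ' (right_ne_zero_of_mul h)⟩
    | sUnion S _ h =>
      obtain ⟨O, hOS, hO⟩ := hφ
      obtain ⟨a, ha, haO⟩ := h O hOS hO
      exact ⟨a, ha, fun φ' h => ⟨O, hOS, haO φ' h⟩⟩
  obtain ⟨a, ha, haO⟩ := key _ (hf {f (P φ)}) φ rfl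
  obtain ⟨b, hb, hbO⟩ := key _ (hf {f (P φ')}) φ' rfl
  have hab : a * b ≠ 0 := mul_ne_zero (fun h => ha (by rw [h, map_zero]))
    (fun h => hb (by rw [h, map_zero]))
  obtain ⟨φ'', h⟩ := exists_algHom_apply_ne_zero (k := k) hab
  rw [map_mul] at h
  exact (haO φ'' (left_ne_zero_of_mul h)).symm.trans (hbO φ'' (right_ne_zero_of_mul h))

end Irreducible

/-! ### Monodromy of the root covers. -/

section RootCover

variable {k C₀ : Type*} [Field k]

/-- The cover of a trace/norm curve obtained by extracting `M`-th roots `t` with `∏ t = 1` of the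
coordinates divided by constants `d`. -/
def RootCover (c : C₀ → Fin 3 → k) (M : ℕ) (d : Fin 3 → k) : Type _ :=
  {p : C₀ × (Fin 3 → k) // ∏ i, p.2 i = 1 ∧ ∀ i, p.2 i ^ M * d i = c p.1 i}

variable {c : C₀ → Fin 3 → k} {M : ℕ} {d : Fin 3 → k}

/-- The six coordinates on the root cover. -/
def RootCover.coords (p : RootCover c M d) : Fin 3 ⊕ Fin 3 → k := Sum.elim (c p.1.1) p.1.2

/-- Roots of unity act on the root cover. -/
def RootCover.twist (p : RootCover c M d) (ζ : Fin 3 → k) (h1 : ∏ i, ζ i = 1)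
    (hM : ∀ i, ζ i ^ M = 1) : RootCover c M d :=
  ⟨(p.1.1, fun i => ζ i * p.1.2 i), by rw [Finset.prod_mul_distrib, h1, p.2.1, one_mul], fun i => by
    rw [mul_pow, hM, one_mul, p.2.2]⟩

/-- Choose M-th roots tᵢ of xᵢ/dᵢ in Ω. The algebra A generated by the xᵢ and tᵢ is a finitely
generated domain whose k-points give points of the root cover, so f ∘ P is constant on them. A
Galois automorphism taking each tᵢ to ζᵢtᵢ preserves A, and composing a k-point with it twists the
corresponding point by ζ. -/
theorem IsTraceNormCurve.exists_twist_eq_aux [IsAlgClosed k] {K Ω : Type*} [Field K] [Algebra k K]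
    [Algebra (coordinateRing c) K] [IsScalarTower k (coordinateRing c) K]
    [IsFractionRing (coordinateRing c) K] [Field Ω] [Algebra k Ω] [Algebra K Ω]
    [IsScalarTower k K Ω] [IsGalois K Ω] [IsSepClosed Ω] {s n : k} (hn : n ≠ 0)
    (hsn : s ^ 3 ≠ 27 * n) (hc : IsTraceNormCurve s n c) (hM : (M : k) ≠ 0) (hd : ∏ i, d i = n)
    {W V E : Type*} [AddCommGroup V] [Module k V] {i : W → V} (P : RootCover c M d → W)
    (hP : ∀ l : Module.Dual k V, (fun p => l (i (P p))) ∈ coordinateRing (RootCover.coords (c := c)))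
    {f : W → E} (hf : @IsLocallyConstant W E (zariskiTopology k i) f) :
    ∃ p : RootCover c M d, ∀ (ζ : Fin 3 → k) (h1 : ∏ i, ζ i = 1) (hζ : ∀ i, ζ i ^ M = 1),
      f (P (p.twist ζ h1 hζ)) = f (P p) := by
  have hM0 : M ≠ 0 := by rintro rfl; simp at hM
  have hd0 (i) : d i ≠ 0 := fun h => hn (by rw [← hd]; exact Finset.prod_eq_zero (Finset.mem_univ i) h)
  have hMK : (M : K) ≠ 0 := by
    rwa [← map_natCast (algebraMap k K), Ne, map_eq_zero]
  have : NeZero (M : Ω) := ⟨by rwa [← map_natCast (algebraMap K Ω), Ne, map_eq_zero]⟩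
  have : NeZero (M : k) := ⟨hM⟩
  have : NeZero M := ⟨hM0⟩
  let x (i : Fin 3) : K := algebraMap (coordinateRing c) K (coordinate c i)
  have hxs : ∑ i, x i = algebraMap k K s := by
    rw [← map_sum, IsScalarTower.algebraMap_apply k (coordinateRing c) K]
    congr 1
    ext x
    simpa [coordinate] using hc.sum_eq x
  have hxn : ∏ i, x i = algebraMap k K n := by
    rw [← map_prod, IsScalarTower.algebraMap_apply k (coordinateRing c) K]
    congr 1
    ext x
    simpa [coordinate] using hc.prod_eq x
  have hx0 (i) : x i ≠ 0 := fun h => hn <| (map_eq_zero (algebraMap k K)).mp <| by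
    rw [← hxn]; exact Finset.prod_eq_zero (Finset.mem_univ i) h
  let xd (i : Fin 3) : K := x i / algebraMap k K (d i)
  have hxd0 (i) : xd i ≠ 0 := div_ne_zero (hx0 i) (by simpa using hd0 i)
  have hxd : ∏ i, xd i = 1 := by
    simp only [xd, Finset.prod_div_distrib, hxn, ← map_prod, hd]
    exact div_self (by simpa using hn)
  obtain ⟨t, htM, htp⟩ : ∃ t : Fin 3 → Ω, (∀ i, t i ^ M = algebraMap K Ω (xd i)) ∧ ∏ i, t i = 1 := by
    obtain ⟨t₀, h₀⟩ := IsSepClosed.exists_pow_nat_eq (algebraMap K Ω (xd 0)) M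
    obtain ⟨t₁, h₁⟩ := IsSepClosed.exists_pow_nat_eq (algebraMap K Ω (xd 1)) M
    have ht₀ : t₀ ≠ 0 := by
      rintro rfl; rw [zero_pow hM0] at h₀; exact hxd0 0 (by simpa using h₀.symm)
    have ht₁ : t₁ ≠ 0 := by
      rintro rfl; rw [zero_pow hM0] at h₁; exact hxd0 1 (by simpa using h₁.symm)
    refine ⟨![t₀, t₁, (t₀ * t₁)⁻¹], fun i => ?_, ?_⟩
    · fin_cases i
      · exact h₀
      · exact h₁
      · change ((t₀ * t₁)⁻¹) ^ M = algebraMap K Ω (xd 2)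
        rw [Fin.prod_univ_three] at hxd
        rw [inv_pow, mul_pow, h₀, h₁, ← map_mul, ← map_inv₀, eq_inv_of_mul_eq_one_right hxd]
    · rw [Fin.prod_univ_three]
      exact mul_inv_cancel₀ (mul_ne_zero ht₀ ht₁)
  have ht0 (i) : t i ≠ 0 := fun h => by
    have := htM i
    rw [h, zero_pow hM0, eq_comm, map_eq_zero] at this
    exact hxd0 i this
  let y : Fin 3 ⊕ Fin 3 → Ω := Sum.elim (fun i => algebraMap K Ω (x i)) t
  let A : Subalgebra k Ω := Algebra.adjoin k (Set.range y)
  have : Algebra.FiniteType k A :=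
    Algebra.FiniteType.adjoin_of_finite (Set.finite_range y)
  let yA (j) : A := ⟨y j, Algebra.subset_adjoin ⟨j, rfl⟩⟩
  have hsum : ∑ i, yA (Sum.inl i) = algebraMap k A s := by
    apply Subtype.ext
    simp only [yA, y, AddSubmonoidClass.coe_finsetSum, Sum.elim_inl, ← map_sum, hxs]
    exact (IsScalarTower.algebraMap_apply k K Ω s).symm
  have hprod : ∏ i, yA (Sum.inl i) = algebraMap k A n := by
    apply Subtype.ext
    simp only [yA, y, SubmonoidClass.coe_finsetProd, Sum.elim_inl, ← map_prod, hxn]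
    exact (IsScalarTower.algebraMap_apply k K Ω n).symm
  have hprod' : ∏ i, yA (Sum.inr i) = 1 := by
    apply Subtype.ext
    simp only [yA, y, SubmonoidClass.coe_finsetProd, Sum.elim_inr]
    exact htp
  have hpow (i) : yA (Sum.inr i) ^ M * algebraMap k A (d i) = yA (Sum.inl i) := by
    apply Subtype.ext
    change t i ^ M * algebraMap k Ω (d i) = algebraMap K Ω (x i)
    rw [htM, IsScalarTower.algebraMap_apply k K Ω, ← map_mul, div_mul_cancel₀]
    simpa using hd0 i
  obtain ⟨v, -, hv⟩ := exists_sum_eq_prod_eq s n one_ne_zero 0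
  have : Nonempty C₀ := (hc.exists_eq v hv.1 hv.2).nonempty
  -- The coordinates c are not assumed injective. One fixed choice of preimage ensures that k-points
  -- with the same xᵢ lie over the same point of `C₀`.
  choose! X hX using hc.exists_eq
  have hXφ (φ : A →ₐ[k] k) : c (X fun i => φ (yA (Sum.inl i))) = fun i => φ (yA (Sum.inl i)) :=
    hX _ (by rw [← map_sum, hsum, AlgHom.commutes]; rfl)
      (by rw [← map_prod, hprod, AlgHom.commutes]; rfl)
  let pt (φ : A →ₐ[k] k) : RootCover c M d :=
    ⟨(X fun i => φ (yA (Sum.inl i)), fun i => φ (yA (Sum.inr i))),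
      by rw [← map_prod, hprod', map_one], fun i => by
        have := congrArg φ (hpow i)
        rw [map_mul, map_pow, AlgHom.commutes] at this
        rw [hXφ]
        exact this⟩
  have hcoords (φ : A →ₐ[k] k) (j) : (pt φ).coords j = φ (yA j) := by
    rcases j with j | j
    · exact congrFun (hXφ φ) j
    · rfl
  have hreg (f) (hf : f ∈ coordinateRing (RootCover.coords (c := c) (M := M) (d := d))) :
      ∃ a : A, ∀ φ, f (pt φ) = φ a := by
    induction hf using Algebra.adjoin_induction with
    | mem f hf => obtain ⟨j, rfl⟩ := hf; exact ⟨yA j, fun φ => hcoords φ j⟩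
    | algebraMap r => exact ⟨algebraMap k A r, fun φ => (AlgHom.commutes φ r).symm⟩
    | add f f' _ _ h h' =>
      obtain ⟨⟨a, h⟩, ⟨a', h'⟩⟩ := And.intro h h'
      exact ⟨a + a', fun φ => by rw [map_add, ← h, ← h']; rfl⟩
    | mul f f' _ _ h h' =>
      obtain ⟨⟨a, h⟩, ⟨a', h'⟩⟩ := And.intro h h'
      exact ⟨a * a', fun φ => by rw [map_mul, ← h, ← h']; rfl⟩
  have hconst := locallyConstant_eq_of_isDomain (i := i) (fun φ => P (pt φ))
    (fun f hf => hreg _ (regularFunctions_comp P hP hf)) hf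
  obtain ⟨φ, -⟩ := exists_algHom_apply_ne_zero (k := k) (one_ne_zero (α := A))
  refine ⟨pt φ, fun ζ h1 hζ => ?_⟩
  -- Only the first two radicals are independent, as the three have product 1. With third exponent
  -- 0, agreement of all exponents modulo M means divisibility of the first two; ζ₂ is then
  -- determined by ζ₀ and ζ₁.
  have hind (b : Fin 2 → ℤ) (g : K) (hg : g ^ M = ∏ᶠ i, xd (Fin.castSucc i) ^ b i) (i) :
      (M : ℤ) ∣ b i := by
    rw [finprod_eq_prod_of_fintype, Fin.prod_univ_two] at hg
    obtain ⟨e, he⟩ := IsAlgClosed.exists_pow_nat_eq (d 0 ^ b 0 * d 1 ^ b 1) (Nat.pos_of_ne_zero hM0)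
    have := hc.modEq_of_pow_eq (K := K) hn hsn hM0 (a := ![b 0, b 1, 0]) (g := g * algebraMap k K e) (by
      rw [mul_pow, hg, ← map_pow, he, Fin.prod_univ_three]
      change (x 0 / algebraMap k K (d 0)) ^ b 0 * (x 1 / algebraMap k K (d 1)) ^ b 1 * _ =
        x 0 ^ b 0 * x 1 ^ b 1 * x 2 ^ (0 : ℤ)
      have e0 : algebraMap k K (d 0) ^ b 0 ≠ 0 := zpow_ne_zero _ (by simpa using hd0 0)
      have e1 : algebraMap k K (d 1) ^ b 1 ≠ 0 := zpow_ne_zero _ (by simpa using hd0 1)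
      rw [div_zpow, div_zpow, map_mul, map_zpow₀, map_zpow₀, zpow_zero]
      field_simp)
    have := this (Fin.castSucc i) 2
    rw [← Int.modEq_zero_iff_dvd]
    fin_cases i <;> exact this
  obtain ⟨γ, hγ⟩ := exists_galois_apply_eq_mul (k := k) hM (fun i : Fin 2 => ht0 (Fin.castSucc i))
    (fun i => htM (Fin.castSucc i)) hind
    (fun i => rootsOfUnity.mkOfPowEq (ζ (Fin.castSucc i)) (hζ _))
  simp only [rootsOfUnity.coe_mkOfPowEq] at hγ
  have hγt (i : Fin 3) : γ (t i) = algebraMap k Ω (ζ i) * t i := by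
    have h0 := hγ 0
    have h1' := hγ 1
    change γ (t 0) = algebraMap k Ω (ζ 0) * t 0 at h0
    change γ (t 1) = algebraMap k Ω (ζ 1) * t 1 at h1'
    rw [Fin.prod_univ_three] at h1 htp
    fin_cases i
    · exact h0
    · exact h1'
    · change γ (t 2) = algebraMap k Ω (ζ 2) * t 2
      have e := congrArg γ htp
      rw [map_mul, map_mul, h0, h1', map_one] at e
      have e' := congrArg (algebraMap k Ω) h1
      rw [map_mul, map_mul, map_one] at e'
      have hne : algebraMap k Ω (ζ 0) * t 0 * (algebraMap k Ω (ζ 1) * t 1) ≠ 0 :=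
        left_ne_zero_of_mul_eq_one e
      apply mul_left_cancel₀ hne
      rw [e]
      linear_combination (-(t 0 * t 1 * t 2)) * e' - htp
  have γk (a : k) : γ (algebraMap k Ω a) = algebraMap k Ω a := by
    rw [IsScalarTower.algebraMap_apply k K Ω, AlgEquiv.commutes]
  let γ' : Ω →ₐ[k] Ω := { (γ : Ω →+* Ω) with commutes' := γk }
  have hγA : A ≤ A.comap γ' := by
    refine Algebra.adjoin_le ?_
    rintro _ ⟨i | i, rfl⟩
    · change γ (algebraMap K Ω (x i)) ∈ A
      rw [AlgEquiv.commutes]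
      exact (yA (Sum.inl i)).2
    · change γ (t i) ∈ A
      rw [hγt]
      exact mul_mem (A.algebraMap_mem _) (yA (Sum.inr i)).2
  let γA : A →ₐ[k] A := (γ'.comp A.val).codRestrict A fun a => hγA a.2
  have hpt : pt (φ.comp γA) = (pt φ).twist ζ h1 hζ := by
    have hl (i) : γA (yA (Sum.inl i)) = yA (Sum.inl i) := Subtype.ext (γ.commutes (x i))
    have hr (i) : γA (yA (Sum.inr i)) = algebraMap k A (ζ i) * yA (Sum.inr i) := Subtype.ext (hγt i)
    apply Subtype.ext
    refine Prod.ext ?_ ?_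
    · change X _ = X _
      simp only [AlgHom.comp_apply, hl]
    · funext i
      change φ (γA _) = ζ i * φ _
      rw [hr, map_mul, AlgHom.commutes]
      rfl
  rw [← hpt]
  exact hconst _ _

/-- A locally constant function on a variety dominated by a root cover of a smooth trace/norm curve
is invariant under the roots of unity, at some point. -/
theorem IsTraceNormCurve.exists_twist_eq [IsAlgClosed k] {s n : k} (hn : n ≠ 0)
    (hsn : s ^ 3 ≠ 27 * n) (hc : IsTraceNormCurve s n c) (hM : (M : k) ≠ 0) (hd : ∏ i, d i = n)
    {W V E : Type*} [AddCommGroup V] [Module k V] {i : W → V} (P : RootCover c M d → W)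
    (hP : ∀ l : Module.Dual k V, (fun p => l (i (P p))) ∈ coordinateRing (RootCover.coords (c := c)))
    {f : W → E} (hf : @IsLocallyConstant W E (zariskiTopology k i) f) :
    ∃ p : RootCover c M d, ∀ (ζ : Fin 3 → k) (h1 : ∏ i, ζ i = 1) (hζ : ∀ i, ζ i ^ M = 1),
      f (P (p.twist ζ h1 hζ)) = f (P p) := by
  have := hc.isDomain hn
  exact hc.exists_twist_eq_aux (K := FractionRing (coordinateRing c))
    (Ω := SeparableClosure (FractionRing (coordinateRing c))) hn hsn hM hd P hP hf

end RootCover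

/-! ### Splitting F̄ ⊗ B into three coordinates. -/

section SplitCoordinates

variable {F B : Type*} [Field F] [CommRing B] [Algebra F B]

@[simp]
theorem coord_tmul (σ : B →ₐ[F] AlgebraicClosure F) (a : AlgebraicClosure F) (b : B) :
    coord σ (a ⊗ₜ b) = a * σ b := by
  simp [coord]

theorem coord_injective :
    Function.Injective (coord : (B →ₐ[F] AlgebraicClosure F) → _) := by
  intro σ τ h
  ext b
  simpa using DFunLike.congr_fun h (1 ⊗ₜ b)

theorem coord_unit_ne_zero (σ : B →ₐ[F] AlgebraicClosure F) (x : (GeomAlg F B)ˣ) :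
    coord σ (x : GeomAlg F B) ≠ 0 :=
  (x.isUnit.map (coord σ)).ne_zero

variable [Module.Finite F B]

/-- Over F̄ the étale algebra becomes a product of copies of F̄ indexed by its spectrum. The three
projections restrict to distinct embeddings of B, and the degree bounds their number by 3. -/
theorem nonempty_equiv_algHom [Algebra.Etale F B] (hB : Module.finrank F B = 3) :
    Nonempty (Fin 3 ≃ (B →ₐ[F] AlgebraicClosure F)) := by
  let E := Algebra.FormallyEtale.equivPiOfIsSepClosed (AlgebraicClosure F) (GeomAlg F B)
  have hfin : Module.Finite (AlgebraicClosure F) (GeomAlg F B) := inferInstance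
  have : IsArtinianRing (GeomAlg F B) := isArtinian_of_tower (AlgebraicClosure F) inferInstance
  have : Fintype (PrimeSpectrum (GeomAlg F B)) := Fintype.ofFinite _
  have h3 : Fintype.card (PrimeSpectrum (GeomAlg F B)) = 3 := by
    rw [← Module.finrank_fintype_fun_eq_card (R := AlgebraicClosure F), ← E.toLinearEquiv.finrank_eq,
      Module.finrank_baseChange, hB]
  let f (p : PrimeSpectrum (GeomAlg F B)) : B →ₐ[F] AlgebraicClosure F :=
    (((Pi.evalAlgHom (AlgebraicClosure F) (fun _ => AlgebraicClosure F) p).comp (E : GeomAlg F B →ₐ[AlgebraicClosure F] _)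
      ).restrictScalars F).comp Algebra.TensorProduct.includeRight
  have hf : Function.Injective f := by
    intro p p' h
    by_contra hp
    have h' : (Pi.evalAlgHom (AlgebraicClosure F) (fun _ => AlgebraicClosure F) p).comp
        (E : GeomAlg F B →ₐ[AlgebraicClosure F] _) = (Pi.evalAlgHom (AlgebraicClosure F) (fun _ => AlgebraicClosure F) p').comp
        (E : GeomAlg F B →ₐ[AlgebraicClosure F] _) := by
      ext b
      exact DFunLike.congr_fun h b
    classical
    have := DFunLike.congr_fun h' (E.symm (Pi.single p 1))
    simp [Ne.symm hp] at this
  have hle := card_algHom_le_finrank F B (AlgebraicClosure F)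
  have : Finite (B →ₐ[F] AlgebraicClosure F) := inferInstance
  have hge := Nat.card_le_card_of_injective f hf
  rw [Nat.card_eq_fintype_card, h3] at hge
  exact ⟨(Finite.equivFinOfCardEq (by omega)).symm⟩

variable (hB : Module.finrank F B = 3) (e : Fin 3 ≃ (B →ₐ[F] AlgebraicClosure F))

/-- The split coordinates `F̄ ⊗ B ≃ F̄ ^ 3`. -/
noncomputable def coordEquiv : GeomAlg F B ≃ₐ[AlgebraicClosure F] (Fin 3 → AlgebraicClosure F) :=
  AlgEquiv.ofBijective (AlgHom.pi fun i => coord (e i)) <| by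
    let k := AlgebraicClosure F
    let L : Fin 3 → Module.Dual k (GeomAlg F B) := fun i => (coord (e i)).toLinearMap
    -- Distinct algebra homomorphisms to a field are linearly independent (Dedekind). Three of them
    -- span the dual of a 3-dimensional space, so they separate points.
    have hL : LinearIndependent k L :=
      (linearIndependent_toLinearMap k (GeomAlg F B) k).comp (fun i => coord (e i))
        (coord_injective.comp e.injective)
    have hd : Module.finrank k (GeomAlg F B) = 3 := by rw [Module.finrank_baseChange, hB]
    have hspan : Submodule.span k (Set.range L) = ⊤ :=
      hL.span_eq_top_of_card_eq_finrank (by rw [Subspace.dual_finrank_eq, hd]; rfl)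
    have hinj : Function.Injective (AlgHom.pi fun i => coord (e i)) := by
      rw [injective_iff_map_eq_zero]
      intro x hx
      rw [← Module.forall_dual_apply_eq_zero_iff k]
      intro l
      have hl : l ∈ Submodule.span k (Set.range L) := hspan ▸ Submodule.mem_top
      induction hl using Submodule.span_induction with
      | mem l hl => obtain ⟨i, rfl⟩ := hl; exact congrFun hx i
      | zero => rfl
      | add l l' _ _ h h' => rw [LinearMap.add_apply, h, h', add_zero]
      | smul a l _ h => rw [LinearMap.smul_apply, h, smul_zero]
    exact ⟨hinj, (LinearMap.injective_iff_surjective_of_finrank_eq_finrank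
      (f := (AlgHom.pi fun i => coord (e i)).toLinearMap) (by rw [hd]; simp)).mp hinj⟩

@[simp]
theorem coordEquiv_apply (x : GeomAlg F B) (i : Fin 3) : coordEquiv hB e x i = coord (e i) x := rfl

theorem coord_coordEquiv_symm (v : Fin 3 → AlgebraicClosure F) (i : Fin 3) :
    coord (e i) ((coordEquiv hB e).symm v) = v i := by
  rw [← coordEquiv_apply hB, AlgEquiv.apply_symm_apply]

include hB in
theorem ext_coord {x y : GeomAlg F B} (h : ∀ i, coord (e i) x = coord (e i) y) : x = y :=
  (coordEquiv hB e).injective (funext h)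

theorem leftMulMatrix_coordEquiv (x : GeomAlg F B) :
    Algebra.leftMulMatrix (Module.Basis.ofEquivFun (coordEquiv hB e).toLinearEquiv) x =
      Matrix.diagonal fun i => coord (e i) x := by
  ext i j
  rw [Algebra.leftMulMatrix_eq_repr_mul, Module.Basis.ofEquivFun_repr_apply, Module.Basis.coe_ofEquivFun]
  change coordEquiv hB e (x * (coordEquiv hB e).symm (Function.update 0 j 1)) i = _
  rw [map_mul, AlgEquiv.apply_symm_apply]
  rcases eq_or_ne i j with rfl | h
  · simp
  · simp [h]

include hB in
theorem trace_eq_sum_coord (x : GeomAlg F B) :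
    Algebra.trace (AlgebraicClosure F) (GeomAlg F B) x = ∑ i, coord (e i) x := by
  rw [Algebra.trace_eq_matrix_trace (Module.Basis.ofEquivFun (coordEquiv hB e).toLinearEquiv),
    leftMulMatrix_coordEquiv, Matrix.trace_diagonal]

include hB in
theorem norm_eq_prod_coord (x : GeomAlg F B) :
    Algebra.norm (AlgebraicClosure F) x = ∏ i, coord (e i) x := by
  rw [Algebra.norm_eq_matrix_det (Module.Basis.ofEquivFun (coordEquiv hB e).toLinearEquiv),
    leftMulMatrix_coordEquiv, Matrix.det_diagonal]

/-- The unit of `F̄ ⊗ B` with given nonzero split coordinates. -/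
noncomputable def unitOfCoord (v : Fin 3 → AlgebraicClosure F) (hv : ∀ i, v i ≠ 0) :
    (GeomAlg F B)ˣ :=
  Units.map (coordEquiv hB e).symm.toMulEquiv.toMonoidHom
    (MulEquiv.piUnits.symm fun i => Units.mk0 (v i) (hv i))

@[simp]
theorem coord_unitOfCoord (v : Fin 3 → AlgebraicClosure F) (hv : ∀ i, v i ≠ 0) (i : Fin 3) :
    coord (e i) (unitOfCoord hB e v hv : GeomAlg F B) = v i :=
  coord_coordEquiv_symm hB e v i

/-- The point of the norm-one torus with given split coordinates. -/
noncomputable def torusOfCoord (v : Fin 3 → AlgebraicClosure F) (hv : ∏ i, v i = 1) :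
    normOneTorus (AlgebraicClosure F) (GeomAlg F B) :=
  ⟨unitOfCoord hB e v fun i h =>
    zero_ne_one ((Finset.prod_eq_zero (Finset.mem_univ i) h).symm.trans hv), by
    refine Units.ext ?_
    change Algebra.norm (AlgebraicClosure F) _ = 1
    rw [norm_eq_prod_coord hB e]
    simpa using hv⟩

@[simp]
theorem coord_torusOfCoord (v : Fin 3 → AlgebraicClosure F) (hv : ∏ i, v i = 1) (i : Fin 3) :
    coord (e i) ((torusOfCoord hB e v hv).1 : GeomAlg F B) = v i :=
  coord_unitOfCoord hB e v _ i

include hB in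
theorem torus_ext {t t' : normOneTorus (AlgebraicClosure F) (GeomAlg F B)}
    (h : ∀ i, coord (e i) (t.1 : GeomAlg F B) = coord (e i) (t'.1 : GeomAlg F B)) : t = t' :=
  Subtype.ext (Units.ext (ext_coord hB e h))

include hB in
theorem prod_coord_torus (t : normOneTorus (AlgebraicClosure F) (GeomAlg F B)) :
    ∏ i, coord (e i) (t.1 : GeomAlg F B) = 1 := by
  rw [← norm_eq_prod_coord hB e]
  exact congrArg Units.val t.2

include hB e in
theorem exists_torus_pow_eq {M : ℕ} (hM : M ≠ 0)
    (t : normOneTorus (AlgebraicClosure F) (GeomAlg F B)) : ∃ u, u ^ M = t := by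
  have ht := prod_coord_torus hB e t
  rw [Fin.prod_univ_three] at ht
  obtain ⟨a, ha⟩ := IsAlgClosed.exists_pow_nat_eq (coord (e 0) (t.1 : GeomAlg F B))
    (Nat.pos_of_ne_zero hM)
  obtain ⟨b, hb⟩ := IsAlgClosed.exists_pow_nat_eq (coord (e 1) (t.1 : GeomAlg F B))
    (Nat.pos_of_ne_zero hM)
  have ha0 : a ≠ 0 := by
    rintro rfl; exact coord_unit_ne_zero (e 0) t.1 (by rw [← ha, zero_pow hM])
  have hb0 : b ≠ 0 := by
    rintro rfl; exact coord_unit_ne_zero (e 1) t.1 (by rw [← hb, zero_pow hM])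
  refine ⟨torusOfCoord hB e ![a, b, (a * b)⁻¹] ?_, torus_ext hB e fun i => ?_⟩
  · rw [Fin.prod_univ_three]
    exact mul_inv_cancel₀ (mul_ne_zero ha0 hb0)
  · rw [Subgroup.coe_pow, Units.val_pow_eq_pow_val, map_pow, coord_torusOfCoord]
    fin_cases i
    · exact ha
    · exact hb
    · change ((a * b)⁻¹) ^ M = coord (e 2) (t.1 : GeomAlg F B)
      rw [inv_pow, mul_pow, ha, hb, eq_inv_of_mul_eq_one_right ht]

/-- The split coordinates of a point of the trace/norm curve. -/
noncomputable def curveCoord {s : F} {n : Fˣ} (x : Curve F B s n) (i : Fin 3) : AlgebraicClosure F :=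
  coord (e i) (x.1.1 : GeomAlg F B)

include hB in
theorem isTraceNormCurve (s : F) (n : Fˣ) :
    IsTraceNormCurve (algebraMap F (AlgebraicClosure F) s) (algebraMap F (AlgebraicClosure F) n)
      (curveCoord e : Curve F B s n → _) where
  sum_eq x := by
    rw [← x.2, trace_eq_sum_coord hB e]; rfl
  prod_eq x := by
    rw [← x.1.2, norm_eq_prod_coord hB e]; rfl
  exists_eq v hs hn := by
    have hv (i) : v i ≠ 0 := fun h => n.ne_zero <| by
      simpa using hn.symm.trans (Finset.prod_eq_zero (Finset.mem_univ i) h)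
    exact ⟨⟨⟨unitOfCoord hB e v hv, by rw [norm_eq_prod_coord hB e]; simpa using hn⟩, by
      rw [trace_eq_sum_coord hB e]; simpa using hs⟩, funext fun i => coord_unitOfCoord hB e v hv i⟩

include hB in
/-- Linear functionals are linear combinations of the split coordinates. -/
theorem exists_dual_eq_sum (l : Module.Dual (AlgebraicClosure F) (GeomAlg F B)) :
    ∃ a : Fin 3 → AlgebraicClosure F, ∀ x, l x = ∑ i, a i * coord (e i) x := by
  refine ⟨fun i => l ((coordEquiv hB e).symm (Pi.single i 1)), fun x => ?_⟩
  conv_lhs => rw [← (coordEquiv hB e).symm_apply_apply x, ← Finset.univ_sum_single (coordEquiv hB e x)]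
  rw [map_sum, map_sum]
  refine Finset.sum_congr rfl fun i _ => ?_
  have : (Pi.single i (coordEquiv hB e x i) : Fin 3 → AlgebraicClosure F) =
      coord (e i) x • Pi.single i 1 := by
    rw [← Pi.single_smul, smul_eq_mul, mul_one, coordEquiv_apply]
  rw [this, map_smul, map_smul, smul_eq_mul, mul_comm]

include hB in
theorem dual_mem {X : Type*} {R : Subalgebra (AlgebraicClosure F) (X → AlgebraicClosure F)}
    {g : X → GeomAlg F B} (h : ∀ i, (fun x => coord (e i) (g x)) ∈ R)
    (l : Module.Dual (AlgebraicClosure F) (GeomAlg F B)) : (fun x => l (g x)) ∈ R := by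
  obtain ⟨a, ha⟩ := exists_dual_eq_sum hB e l
  have : (fun x => l (g x)) = ∑ i, a i • fun x => coord (e i) (g x) := by
    ext x; simp [ha]
  rw [this]
  exact sum_mem fun i _ => R.smul_mem (h i) _

include hB in
theorem curveRing_eq (s : F) (n : Fˣ) :
    CurveRing F B s n = coordinateRing (curveCoord e : Curve F B s n → _) := by
  apply le_antisymm
  · refine Algebra.adjoin_le ?_
    rintro _ ⟨l, rfl⟩
    exact dual_mem hB e (fun i => (coordinate (curveCoord e) i).2) l
  · refine Algebra.adjoin_le ?_
    rintro _ ⟨i, rfl⟩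
    exact Algebra.subset_adjoin (Set.mem_range_self (coord (e i)).toLinearMap)

end SplitCoordinates

/-! ### Monomials as units, N-th powers and characters. -/

section Monomials

theorem prod_zpow_eq {L : Type*} [CommGroupWithZero L] {X : Fin 3 → L} (hX : ∀ i, X i ≠ 0)
    {N : ℕ} {a m : Fin 3 → ℤ} (ha : ∀ i, a i = a 0 + N * m i) :
    ∏ i, X i ^ a i = (∏ i, X i) ^ a 0 * (∏ i, X i ^ m i) ^ N := by
  rw [← Finset.prod_zpow, ← Finset.prod_pow, ← Finset.prod_mul_distrib]
  refine Finset.prod_congr rfl fun i _ => ?_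
  rw [ha, zpow_add₀ (hX i), mul_comm (N : ℤ), zpow_mul, zpow_natCast]

theorem exists_eq_add_mul {N : ℕ} {a : Fin 3 → ℤ} (ha : ∀ i j, a i ≡ a j [ZMOD N]) :
    ∃ m : Fin 3 → ℤ, ∀ i, a i = a 0 + N * m i := by
  choose m hm using fun i => (ha 0 i).dvd
  exact ⟨m, fun i => by rw [← hm]; ring⟩

theorem map_units_prod_zpow {R L : Type*} [CommRing R] [Field L] (u : Fin 3 → Rˣ) (a : Fin 3 → ℤ)
    (φ : R →+* L) : φ (∏ i, u i ^ a i : Rˣ) = ∏ i, φ (u i) ^ a i := by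
  rw [Units.coe_prod, map_prod]
  refine Finset.prod_congr rfl fun i _ => ?_
  have := congrArg Units.val (map_zpow (Units.map (φ : R →* L)) (u i) (a i))
  rwa [Units.val_zpow_eq_zpow_val] at this

variable {k : Type*} [Field k]

/-- Since the product is a nonzero constant, the inverse of one factor is a scalar multiple of the
product of the others. -/
theorem zpow_mem_of_prod_eq {X : Type*} {R : Subalgebra k (X → k)} {u : Fin 3 → X → k}
    (hu : ∀ i, u i ∈ R) {ν : k} (hν : ν ≠ 0) (h : ∀ x, ∏ i, u i x = ν) (i : Fin 3) (a : ℤ) :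
    (fun x => u i x ^ a) ∈ R := by
  have hinv : (fun x => (u i x)⁻¹) ∈ R := by
    have : (fun x => (u i x)⁻¹) = ν⁻¹ • ∏ j ∈ Finset.univ.erase i, u j := by
      ext x
      have hx := h x
      rw [← Finset.mul_prod_erase _ _ (Finset.mem_univ i)] at hx
      simp only [Pi.smul_apply, Finset.prod_apply, smul_eq_mul]
      rw [← hx] at hν ⊢
      have := left_ne_zero_of_mul hν
      have := right_ne_zero_of_mul hν
      field_simp
    rw [this]
    exact R.smul_mem (prod_mem fun j _ => hu j) _
  obtain ⟨j, rfl | rfl⟩ := a.eq_nat_or_neg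
  · simp only [zpow_natCast]
    exact pow_mem (hu i) j
  · simpa [Pi.pow_def] using pow_mem hinv j

variable {C₀ : Type*} {s n : k} {c : C₀ → Fin 3 → k}

/-- Monomials in the coordinates of a smooth trace/norm curve. -/
theorem IsTraceNormCurve.exists_unit_monomial [IsAlgClosed k] (hn : n ≠ 0) (hsn : s ^ 3 ≠ 27 * n)
    (hc : IsTraceNormCurve s n c) {N : ℕ} (hN : N ≠ 0) (a : Fin 3 → ℤ) :
    ∃ f : (coordinateRing c)ˣ, (∀ x, f.1.1 x = ∏ i, c x i ^ a i) ∧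
      ((∃ g : FractionRing (coordinateRing c), g ^ N = algebraMap (coordinateRing c) _ f) ↔
        ∀ i j, a i ≡ a j [ZMOD N]) := by
  have := hc.isDomain hn
  have hc0 (x : C₀) (i : Fin 3) : c x i ≠ 0 := fun h => hn <| by
    rw [← hc.prod_eq x]; exact Finset.prod_eq_zero (Finset.mem_univ i) h
  have hmem (i : Fin 3) : (fun x => (c x i)⁻¹) ∈ coordinateRing c := by
    have := zpow_mem_of_prod_eq (fun j => (coordinate c j).2) hn hc.prod_eq i (-1)
    simp only [zpow_neg_one] at this
    exact this
  let u (i : Fin 3) : (coordinateRing c)ˣ :=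
    ⟨coordinate c i, ⟨_, hmem i⟩, Subtype.ext (funext fun x => mul_inv_cancel₀ (hc0 x i)),
      Subtype.ext (funext fun x => inv_mul_cancel₀ (hc0 x i))⟩
  refine ⟨∏ i, u i ^ a i, fun x => ?_, ?_, fun ha => ?_⟩
  · exact map_units_prod_zpow u a (((Pi.evalRingHom (fun _ : C₀ => k) x)).comp (coordinateRing c).val.toRingHom)
  · rintro ⟨g, hg⟩
    rw [map_units_prod_zpow] at hg
    exact hc.modEq_of_pow_eq hn hsn hN hg
  · obtain ⟨m, hm⟩ := exists_eq_add_mul ha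
    -- With all exponents congruent to a₀, the monomial is (x₀x₁x₂)^a₀ = n^a₀ times an N-th power; d
    -- is an N-th root of this constant.
    obtain ⟨d, hd⟩ := IsAlgClosed.exists_pow_nat_eq (n ^ a 0) (Nat.pos_of_ne_zero hN)
    have hX (i) : algebraMap (coordinateRing c) (FractionRing (coordinateRing c))
        (coordinate c i) ≠ 0 :=
      ((u i).isUnit.map (algebraMap (coordinateRing c) (FractionRing (coordinateRing c)))).ne_zero
    have hprod : ∏ i, coordinate c i = algebraMap k (coordinateRing c) n := by
      ext x
      simpa [coordinate] using hc.prod_eq x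
    rw [map_units_prod_zpow]
    refine ⟨algebraMap k _ d * ∏ i, algebraMap (coordinateRing c) _ (coordinate c i) ^ m i, ?_⟩
    rw [prod_zpow_eq hX hm, mul_pow, ← map_pow, hd, ← map_prod, hprod, map_zpow₀,
      ← IsScalarTower.algebraMap_apply k (coordinateRing c)]

/-- The fibre over v is the nonvanishing locus of the product of ρ - u over the other values u. -/
theorem isLocallyConstant_of_finite_range {X V : Type*} [AddCommGroup V] [Module k V] {i : X → V}
    {ρ : X → k} (hρ : ρ ∈ regularFunctions k i) (h : (Set.range ρ).Finite) :
    @IsLocallyConstant X k (zariskiTopology k i) ρ := by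
  classical
  let := zariskiTopology k i
  rw [IsLocallyConstant.iff_isOpen_fiber]
  intro v
  refine TopologicalSpace.isOpen_generateFrom_of_mem
    ⟨∏ u ∈ h.toFinset.erase v, (ρ - algebraMap k (X → k) u),
      prod_mem fun u _ => sub_mem hρ (Subalgebra.algebraMap_mem _ u), ?_⟩
  ext x
  simp only [Set.mem_preimage, Set.mem_singleton_iff, Set.mem_ofPred_eq, Finset.prod_apply,
    Pi.sub_apply, Pi.algebraMap_apply, Finset.prod_ne_zero_iff, sub_ne_zero]
  constructor
  · rintro rfl u hu
    exact (Finset.ne_of_mem_erase hu).symm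
  · intro hx
    by_contra hv
    exact hx (ρ x) (Finset.mem_erase.mpr ⟨hv, h.mem_toFinset.mpr ⟨x, rfl⟩⟩) rfl

/-- If a monomial is one on all triples of `N`-th roots of unity with product one, its exponents agree
modulo `N`. -/
theorem modEq_of_prod_zpow_eq_one {N : ℕ} {z : k} (hz : IsPrimitiveRoot z N) (hN : N ≠ 0)
    {a : Fin 3 → ℤ} (h : ∀ ζ : Fin 3 → k, ∏ i, ζ i = 1 → (∀ i, ζ i ^ N = 1) → ∏ i, ζ i ^ a i = 1)
    (i j : Fin 3) : a i ≡ a j [ZMOD N] := by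
  classical
  rcases eq_or_ne i j with rfl | hij
  · rfl
  have hz0 : z ≠ 0 := hz.ne_zero hN
  -- Test with z at i, z⁻¹ at j and 1 elsewhere: the monomial becomes z^(aᵢ - aⱼ).
  let ζ : Fin 3 → k := Pi.mulSingle i z * Pi.mulSingle j z⁻¹
  have e (b : Fin 3 → ℤ) : ∏ l, ζ l ^ b l = z ^ (b i - b j) := by
    have e1 (l : Fin 3) : ζ l ^ b l =
        (Pi.mulSingle i (z ^ b i) : Fin 3 → k) l * (Pi.mulSingle j (z ^ (-b j)) : Fin 3 → k) l := by
      simp only [ζ, Pi.mul_apply, mul_zpow, Pi.mulSingle_apply]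
      split_ifs <;> simp_all
    rw [Finset.prod_congr rfl fun l _ => e1 l, Finset.prod_mul_distrib, Finset.prod_pi_mulSingle',
      Finset.prod_pi_mulSingle', if_pos (Finset.mem_univ i), if_pos (Finset.mem_univ j),
      ← zpow_add₀ hz0, sub_eq_add_neg]
  have h1 := h ζ (by simpa using e 1) fun l => by
    simp only [ζ, Pi.mul_apply, mul_pow, Pi.mulSingle_apply]
    split_ifs <;> simp [hz.pow_eq_one]
  rw [e, hz.zpow_eq_one_iff_dvd] at h1
  exact (Int.modEq_iff_dvd.mpr h1).symm

end Monomials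

/-! ### Pullbacks of Kummer sheaves. -/

section Kummer

variable {F B : Type*} [Field F] [CommRing B] [Algebra F B]
  (hB : Module.finrank F B = 3) (e : Fin 3 ≃ (B →ₐ[F] AlgebraicClosure F))

theorem coe_monomial (a : Fin 3 → ℤ) (x : (GeomAlg F B)ˣ) :
    (monomial e a x : AlgebraicClosure F) = ∏ i, coord (e i) (x : GeomAlg F B) ^ a i := by
  simp [monomial, Units.coe_prod]

theorem monomial_mul (a : Fin 3 → ℤ) (x y : (GeomAlg F B)ˣ) :
    monomial e a (x * y) = monomial e a x * monomial e a y := by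
  simp only [monomial, map_mul, mul_zpow, Finset.prod_mul_distrib]

theorem monomial_pow (a : Fin 3 → ℤ) (x : (GeomAlg F B)ˣ) (N : ℕ) :
    monomial e a (x ^ N) = monomial e a x ^ N := by
  induction N with
  | zero => simp [monomial]
  | succ N ih => rw [pow_succ, monomial_mul, ih, pow_succ]

variable {s : F} {n : Fˣ} (x₀ : NormFiber F B n)

/-- The split coordinates of a point of the norm fibre. -/
noncomputable def fiberCoord (i : Fin 3) : AlgebraicClosure F := coord (e i) (x₀.1 : GeomAlg F B)

theorem fiberCoord_ne_zero (i : Fin 3) : fiberCoord e x₀ i ≠ 0 := coord_unit_ne_zero _ _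

theorem coord_trivialization (x : Curve F B s n) (i : Fin 3) :
    coord (e i) ((trivialization x₀ x.1).1 : GeomAlg F B) = curveCoord e x i / fiberCoord e x₀ i := by
  rw [eq_div_iff (fiberCoord_ne_zero e x₀ i), fiberCoord, ← map_mul, curveCoord, mul_comm]
  change coord (e i) ((x₀.1 * (x₀.1⁻¹ * x.1.1) : (GeomAlg F B)ˣ) : GeomAlg F B) = _
  rw [mul_inv_cancel_left]

variable {M : ℕ}

theorem coord_mem_coordinateRing (i : Fin 3) :
    (fun p : RootCover (curveCoord e : Curve F B s n → _) M (fiberCoord e x₀) =>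
      coord (e i) (p.1.1.1.1 : GeomAlg F B)) ∈
      coordinateRing (RootCover.coords (c := (curveCoord e : Curve F B s n → _)) (M := M)
        (d := fiberCoord e x₀)) :=
  (coordinate _ (Sum.inl i)).2

theorem natCast_ne_zero_of_coprime [Finite F] {N : ℕ} (hN : N.Coprime (ringChar F)) :
    (N : AlgebraicClosure F) ≠ 0 := by
  have hp : (ringChar F).Prime := (CharP.char_is_prime_or_zero F (ringChar F)).resolve_right
    (CharP.char_ne_zero_of_finite F _)
  rw [← map_natCast (algebraMap F (AlgebraicClosure F)), Ne, map_eq_zero, ringChar.spec]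
  intro h
  exact hp.one_lt.ne' (Nat.eq_one_of_dvd_coprimes hN h dvd_rfl)

variable [Module.Finite F B]

theorem torusOfCoord_mul {v w : Fin 3 → AlgebraicClosure F} (hv : ∏ i, v i = 1)
    (hw : ∏ i, w i = 1) :
    torusOfCoord hB e (fun i => v i * w i) (by rw [Finset.prod_mul_distrib, hv, hw, one_mul]) =
      torusOfCoord hB e v hv * torusOfCoord hB e w hw := by
  refine torus_ext hB e fun i => ?_
  rw [coord_torusOfCoord, Subgroup.coe_mul, Units.val_mul, map_mul, coord_torusOfCoord,
    coord_torusOfCoord]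

include hB in
theorem prod_fiberCoord : ∏ i, fiberCoord e x₀ i = algebraMap F (AlgebraicClosure F) n := by
  rw [← x₀.2, norm_eq_prod_coord hB e]; rfl

/-- The point of the norm-one torus below a point of a root cover. -/
noncomputable def RootCover.torus
    (p : RootCover (curveCoord e : Curve F B s n → _) M (fiberCoord e x₀)) :
    normOneTorus (AlgebraicClosure F) (GeomAlg F B) :=
  torusOfCoord hB e p.1.2 p.2.1

theorem RootCover.torus_pow
    (p : RootCover (curveCoord e : Curve F B s n → _) M (fiberCoord e x₀)) :
    p.torus hB e x₀ ^ M = trivialization x₀ p.1.1.1 := by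
  refine torus_ext hB e fun i => ?_
  rw [coord_trivialization, eq_div_iff (fiberCoord_ne_zero e x₀ i), ← p.2.2 i, Subgroup.coe_pow,
    Units.val_pow_eq_pow_val, map_pow, RootCover.torus, coord_torusOfCoord]

theorem RootCover.torus_twist
    (p : RootCover (curveCoord e : Curve F B s n → _) M (fiberCoord e x₀))
    (ζ : Fin 3 → AlgebraicClosure F) (h1 : ∏ i, ζ i = 1) (hM : ∀ i, ζ i ^ M = 1) :
    (p.twist ζ h1 hM).torus hB e x₀ = torusOfCoord hB e ζ h1 * p.torus hB e x₀ :=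
  torusOfCoord_mul hB e h1 p.2.1

theorem coord_torus_mem_coordinateRing (i : Fin 3) :
    (fun p : RootCover (curveCoord e : Curve F B s n → _) M (fiberCoord e x₀) =>
      coord (e i) ((p.torus hB e x₀).1 : GeomAlg F B)) ∈
      coordinateRing (RootCover.coords (c := (curveCoord e : Curve F B s n → _)) (M := M)
        (d := fiberCoord e x₀)) := by
  simp only [RootCover.torus, coord_torusOfCoord]
  exact (coordinate (RootCover.coords (c := (curveCoord e : Curve F B s n → _)) (M := M)
    (d := fiberCoord e x₀)) (Sum.inr i)).2

variable {E : Type*} [Field E]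

include hB in
-- As t₁t₂t₃ = 1 on the torus, congruent exponents make t^a equal to (t^m)^N. Then y/t^m is a
-- regular function with values in μ_N, hence locally constant, and ψ of it is a nowhere zero
-- section.
theorem kummer_trivial_of_modEq {N : ℕ} (hN : N ≠ 0)
    (ψ : rootsOfUnity N (AlgebraicClosure F) →* Eˣ) {a : Fin 3 → ℤ}
    (ha : ∀ i j, a i ≡ a j [ZMOD N]) : IsTrivialRankOne (KummerCover s e N a x₀) ψ := by
  have : NeZero N := ⟨hN⟩
  obtain ⟨m, hm⟩ := exists_eq_add_mul ha
  have hmono (x : normOneTorus (AlgebraicClosure F) (GeomAlg F B)) :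
      monomial e a x.1 = monomial e m x.1 ^ N := by
    apply Units.ext
    rw [Units.val_pow_eq_pow_val, coe_monomial, coe_monomial,
      prod_zpow_eq (fun i => coord_unit_ne_zero (e i) x.1) hm, prod_coord_torus hB, one_zpow, one_mul]
  let ρ (w : KummerCover s e N a x₀) : rootsOfUnity N (AlgebraicClosure F) :=
    ⟨w.1.2 / monomial e m (trivialization x₀ w.1.1.1).1, by
      rw [mem_rootsOfUnity, div_pow, w.2, hmono, div_self']⟩
  have hρmem : (fun w => ((ρ w : (AlgebraicClosure F)ˣ) : AlgebraicClosure F)) ∈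
      regularFunctions (AlgebraicClosure F) (V := GeomAlg F B × AlgebraicClosure F)
        (fun p : KummerCover s e N a x₀ => (p.1.1.1.1, p.1.2)) := by
    set R := regularFunctions (AlgebraicClosure F) (V := GeomAlg F B × AlgebraicClosure F)
        (fun p : KummerCover s e N a x₀ => (p.1.1.1.1, p.1.2))
    have hy : (fun w : KummerCover s e N a x₀ => (w.1.2 : AlgebraicClosure F)) ∈ R :=
      Algebra.subset_adjoin (Set.mem_range_self (LinearMap.snd _ _ _))
    have hx (i : Fin 3) : (fun w : KummerCover s e N a x₀ => curveCoord e w.1.1 i) ∈ R :=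
      Algebra.subset_adjoin
        (Set.mem_range_self ((coord (e i)).toLinearMap.comp (LinearMap.fst _ _ _)))
    have hτ (i : Fin 3) : (fun w : KummerCover s e N a x₀ =>
        coord (e i) ((trivialization x₀ w.1.1.1).1 : GeomAlg F B)) ∈ R := by
      simp only [coord_trivialization]
      have := R.smul_mem (hx i) (fiberCoord e x₀ i)⁻¹
      convert this using 2 with w
      rw [Pi.smul_apply, smul_eq_mul, div_eq_inv_mul]
    have hτz (i : Fin 3) := zpow_mem_of_prod_eq hτ one_ne_zero
      (fun w => prod_coord_torus hB e (trivialization x₀ w.1.1.1)) i (-m i)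
    convert mul_mem hy (prod_mem fun i (_ : i ∈ Finset.univ) => hτz i) using 1
    ext w
    simp only [ρ, Pi.mul_apply, Finset.prod_apply, Units.val_div_eq_div_val, coe_monomial]
    simp only [zpow_neg, Finset.prod_inv_distrib, div_eq_mul_inv]
  have hρ : IsLocallyConstant ρ := by
    refine IsLocallyConstant.desc ρ
      (fun u : rootsOfUnity N (AlgebraicClosure F) => ((u : (AlgebraicClosure F)ˣ) : AlgebraicClosure F))
      (isLocallyConstant_of_finite_range hρmem ?_) (Units.val_injective.comp Subtype.val_injective)
    refine (Set.finite_range fun u : rootsOfUnity N (AlgebraicClosure F) =>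
      ((u : (AlgebraicClosure F)ˣ) : AlgebraicClosure F)).subset ?_
    rintro _ ⟨w, rfl⟩
    exact ⟨ρ w, rfl⟩
  refine ⟨fun w => ψ (ρ w), ⟨hρ.comp fun u => (ψ u : E), fun ζ w => ?_⟩, fun w => (ψ (ρ w)).ne_zero⟩
  have : ρ (ζ • w) = ζ * ρ w := by
    apply Subtype.ext
    exact mul_div_assoc ζ.1 w.1.2 _
  simp only [this, map_mul, Units.val_mul]

include hB in
-- The root cover with M = N maps to the Kummer torsor by y = t^a, and twisting by ζ becomes the
-- action of ζ^a ∈ μ_N. Invariance of a nowhere zero section gives ψ(ζ^a) = 1, so ζ^a = 1 for every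
-- admissible ζ.
theorem modEq_of_kummer_trivial {N : ℕ} (hN : (N : AlgebraicClosure F) ≠ 0)
    (hsn : s ^ 3 ≠ 27 * (n : F))
    {ψ : rootsOfUnity N (AlgebraicClosure F) →* Eˣ} (hψ : Function.Injective ψ) {a : Fin 3 → ℤ}
    (h : IsTrivialRankOne (KummerCover s e N a x₀) ψ) (i j : Fin 3) : a i ≡ a j [ZMOD N] := by
  have hN0 : N ≠ 0 := by rintro rfl; simp at hN
  have : NeZero N := ⟨hN0⟩
  have : NeZero (N : AlgebraicClosure F) := ⟨hN⟩
  obtain ⟨f, ⟨hf, hfψ⟩, hf0⟩ := h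
  let P (p : RootCover (curveCoord e : Curve F B s n → _) N (fiberCoord e x₀)) :
      KummerCover s e N a x₀ :=
    ⟨(p.1.1, monomial e a (p.torus hB e x₀).1), by
      rw [← monomial_pow, ← RootCover.torus_pow hB e x₀ p]; rfl⟩
  obtain ⟨p, hp⟩ := (isTraceNormCurve hB e s n).exists_twist_eq
    (by simp) (by
      rw [← map_pow, ← map_ofNat (algebraMap F (AlgebraicClosure F)), ← map_mul]
      exact (algebraMap F (AlgebraicClosure F)).injective.ne hsn) hN (prod_fiberCoord hB e x₀)
    (i := fun w : KummerCover s e N a x₀ =>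
      ((w.1.1.1.1 : GeomAlg F B), (w.1.2 : AlgebraicClosure F))) P (by
      intro l
      have h1 := dual_mem hB e (coord_mem_coordinateRing e x₀ (s := s) (M := N))
        (l.comp (LinearMap.inl _ _ _))
      have h2 := prod_mem fun i (_ : i ∈ Finset.univ) => zpow_mem_of_prod_eq
        (coord_torus_mem_coordinateRing hB e x₀ (s := s) (M := N)) one_ne_zero
        (fun p => prod_coord_torus hB e (p.torus hB e x₀)) i (a i)
      convert add_mem h1 (Subalgebra.smul_mem _ h2 (l (0, 1))) using 1
      ext p
      simp only [Pi.add_apply, Pi.smul_apply, Finset.prod_apply, LinearMap.comp_apply,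
        LinearMap.inl_apply, P, ← coe_monomial]
      rw [smul_eq_mul, mul_comm, ← smul_eq_mul, ← map_smul, ← map_add]
      simp) hf
  obtain ⟨z, hz⟩ := HasEnoughRootsOfUnity.exists_primitiveRoot (AlgebraicClosure F) N
  refine modEq_of_prod_zpow_eq_one hz hN0 (fun ζ h1 hζ => ?_) i j
  let ξ : rootsOfUnity N (AlgebraicClosure F) := ⟨monomial e a (torusOfCoord hB e ζ h1).1, by
    have : torusOfCoord hB e ζ h1 ^ N = 1 := by
      refine torus_ext hB e fun i => ?_
      rw [Subgroup.coe_pow, Units.val_pow_eq_pow_val, map_pow, coord_torusOfCoord, hζ]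
      exact (map_one _).symm
    rw [mem_rootsOfUnity, ← monomial_pow, ← Subgroup.coe_pow, this]
    simp [monomial]⟩
  have hPξ : P (p.twist ζ h1 hζ) = ξ • P p := by
    apply Subtype.ext
    refine Prod.ext rfl ?_
    change monomial e a ((p.twist ζ h1 hζ).torus hB e x₀).1 = _ * monomial e a (p.torus hB e x₀).1
    rw [RootCover.torus_twist, Subgroup.coe_mul, monomial_mul]
  have hψξ : ψ ξ = 1 := by
    have := hp ζ h1 hζ
    rw [hPξ, hfψ] at this
    exact Units.ext (mul_right_cancel₀ (hf0 (P p)) (this.trans (one_mul _).symm))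
  have hξ : ξ = 1 := hψ (hψξ.trans (map_one ψ).symm)
  have := congrArg (fun u : rootsOfUnity N (AlgebraicClosure F) =>
    ((u : (AlgebraicClosure F)ˣ) : AlgebraicClosure F)) hξ
  simpa [ξ, coe_monomial] using this

end Kummer

/-! ### Pullbacks of Lang sheaves. -/

section Lang

variable {F B : Type*} [Field F] [Fintype F] [CommRing B] [Algebra F B]

/-- Frobenius permutes the embeddings of `B`. -/
noncomputable def frobEmb (σ : B →ₐ[F] AlgebraicClosure F) : B →ₐ[F] AlgebraicClosure F :=
  (FiniteField.frobeniusAlgEquivOfAlgebraic F (AlgebraicClosure F) :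
    AlgebraicClosure F →ₐ[F] AlgebraicClosure F).comp σ

theorem frobEmb_injective : Function.Injective (frobEmb : (B →ₐ[F] AlgebraicClosure F) → _) := by
  intro σ τ h
  ext b
  exact (FiniteField.frobeniusAlgEquivOfAlgebraic F (AlgebraicClosure F)).injective
    (DFunLike.congr_fun h b)

/-- In split coordinates Frobenius raises entries to the q-th power and also permutes the positions.
-/
theorem coord_frobEmb_frob (σ : B →ₐ[F] AlgebraicClosure F) (x : GeomAlg F B) :
    coord (frobEmb σ) (frob F B x) = coord σ x ^ Fintype.card F := by
  have h : ((coord (frobEmb σ)).restrictScalars F).comp (frob F B : GeomAlg F B →ₐ[F] GeomAlg F B) =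
      (FiniteField.frobeniusAlgEquivOfAlgebraic F (AlgebraicClosure F) :
        AlgebraicClosure F →ₐ[F] AlgebraicClosure F).comp ((coord σ).restrictScalars F) := by
    refine Algebra.TensorProduct.ext' fun a b => ?_
    simp [frob, frobEmb, mul_pow]
  simpa [FiniteField.coe_frobeniusAlgEquivOfAlgebraic] using DFunLike.congr_fun h x

theorem coord_frobTorus (σ : B →ₐ[F] AlgebraicClosure F)
    (t : normOneTorus (AlgebraicClosure F) (GeomAlg F B)) :
    coord (frobEmb σ) ((frobTorus F B t).1 : GeomAlg F B) =
      coord σ (t.1 : GeomAlg F B) ^ Fintype.card F :=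
  coord_frobEmb_frob σ _

theorem coord_iterate_frobTorus (σ : B →ₐ[F] AlgebraicClosure F)
    (t : normOneTorus (AlgebraicClosure F) (GeomAlg F B)) (j : ℕ) :
    coord (frobEmb^[j] σ) (((frobTorus F B)^[j] t).1 : GeomAlg F B) =
      coord σ (t.1 : GeomAlg F B) ^ Fintype.card F ^ j := by
  induction j with
  | zero => simp
  | succ j ih =>
    rw [Function.iterate_succ_apply', Function.iterate_succ_apply', coord_frobTorus, ih, ← pow_mul,
      pow_succ]

/-- The product of the first `m` Frobenius conjugates of a point of the norm-one torus. -/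
noncomputable def frobNorm (m : ℕ) (t : normOneTorus (AlgebraicClosure F) (GeomAlg F B)) :
    normOneTorus (AlgebraicClosure F) (GeomAlg F B) :=
  ∏ j ∈ Finset.range m, (frobTorus F B)^[j] t

theorem frobNorm_mul (m : ℕ) (t t' : normOneTorus (AlgebraicClosure F) (GeomAlg F B)) :
    frobNorm m (t * t') = frobNorm m t * frobNorm m t' := by
  simp only [frobNorm, iterate_map_mul, Finset.prod_mul_distrib]

theorem langMap_apply (t : normOneTorus (AlgebraicClosure F) (GeomAlg F B)) :
    langMap F B t = frobTorus F B t / t := rfl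

theorem frobNorm_langMap (m : ℕ) (t : normOneTorus (AlgebraicClosure F) (GeomAlg F B)) :
    frobNorm m (langMap F B t) = (frobTorus F B)^[m] t / t := by
  rw [frobNorm, langMap_apply]
  simp only [iterate_map_div, ← Function.iterate_succ_apply]
  exact Finset.prod_range_div (fun j => (frobTorus F B)^[j] t) m

/-- The product telescopes. Once m iterations of `frobEmb` fix all embeddings, the right side is
t^(q^m - 1), so this power map factors through the Lang map. -/
theorem langMap_frobNorm (m : ℕ) (t : normOneTorus (AlgebraicClosure F) (GeomAlg F B)) :
    langMap F B (frobNorm m t) = (frobTorus F B)^[m] t / t := by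
  rw [frobNorm, map_prod]
  simp only [langMap_apply, ← Function.iterate_succ_apply']
  exact Finset.prod_range_div (fun j => (frobTorus F B)^[j] t) m

variable [Module.Finite F B]

theorem exists_iterate_frobEmb_eq :
    ∃ m, 0 < m ∧ ∀ σ : B →ₐ[F] AlgebraicClosure F, frobEmb^[m] σ = σ := by
  have : Finite (B →ₐ[F] AlgebraicClosure F) := inferInstance
  let π : Equiv.Perm (B →ₐ[F] AlgebraicClosure F) :=
    Equiv.ofBijective frobEmb (Finite.injective_iff_bijective.mp frobEmb_injective)
  refine ⟨orderOf π, orderOf_pos π, fun σ => ?_⟩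
  have := Equiv.Perm.iterate_eq_pow π (orderOf π)
  rw [pow_orderOf_eq_one] at this
  exact congrFun this σ

variable (hB : Module.finrank F B = 3) (e : Fin 3 ≃ (B →ₐ[F] AlgebraicClosure F))

include hB in
theorem iterate_frobTorus_div {m : ℕ} (hm : ∀ σ : B →ₐ[F] AlgebraicClosure F, frobEmb^[m] σ = σ)
    (e : Fin 3 ≃ (B →ₐ[F] AlgebraicClosure F))
    (t : normOneTorus (AlgebraicClosure F) (GeomAlg F B)) :
    (frobTorus F B)^[m] t / t = t ^ (Fintype.card F ^ m - 1) := by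
  rw [div_eq_iff_eq_mul, ← pow_succ, Nat.sub_add_cancel (Nat.one_le_pow _ _ Fintype.card_pos)]
  refine torus_ext hB e fun i => ?_
  have := coord_iterate_frobTorus (e i) t m
  rw [hm] at this
  rw [this, Subgroup.coe_pow, Units.val_pow_eq_pow_val, map_pow]

variable {s : F} {n : Fˣ} (x₀ : NormFiber F B n) {E : Type*} [Field E]

include hB e in
-- The root cover with M = q^m - 1 maps to the Lang torsor by `frobNorm m`, and M-torsion of the
-- torus surjects onto the deck group T(F). Invariance of a nowhere zero section therefore kills χ
-- on all of T(F).
theorem eq_one_of_lang_trivial (hsn : s ^ 3 ≠ 27 * (n : F)) {χ : normOneTorus F B →* Eˣ}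
    (h : IsTrivialRankOne (LangCover s x₀) χ) : χ = 1 := by
  obtain ⟨f, ⟨hf, hfχ⟩, hf0⟩ := h
  obtain ⟨m, hm0, hm⟩ := exists_iterate_frobEmb_eq (F := F) (B := B)
  set M := Fintype.card F ^ m - 1 with hMdef
  have hpow (t : normOneTorus (AlgebraicClosure F) (GeomAlg F B)) :=
    iterate_frobTorus_div hB hm e t
  -- Since m > 0, q^m vanishes in F̄ and M becomes -1.
  have hM : (M : AlgebraicClosure F) ≠ 0 := by
    rw [hMdef, Nat.cast_sub (Nat.one_le_pow _ _ Fintype.card_pos), Nat.cast_pow,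
      ← map_natCast (algebraMap F (AlgebraicClosure F)), Nat.cast_card_eq_zero, map_zero,
      zero_pow hm0.ne']
    simp
  have hM0 : M ≠ 0 := by rintro h; rw [h] at hM; simp at hM
  let P (p : RootCover (curveCoord e : Curve F B s n → _) M (fiberCoord e x₀)) : LangCover s x₀ :=
    ⟨(p.1.1, frobNorm m (p.torus hB e x₀)), by
      rw [langMap_frobNorm, hpow, RootCover.torus_pow]⟩
  obtain ⟨p, hp⟩ := (isTraceNormCurve hB e s n).exists_twist_eq
    (by simp) (by
      rw [← map_pow, ← map_ofNat (algebraMap F (AlgebraicClosure F)), ← map_mul]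
      exact (algebraMap F (AlgebraicClosure F)).injective.ne hsn) hM (prod_fiberCoord hB e x₀)
    (i := fun w : LangCover s x₀ => ((w.1.1.1.1 : GeomAlg F B), (w.1.2.1 : GeomAlg F B))) P (by
      intro l
      have h1 := dual_mem hB e (coord_mem_coordinateRing e x₀ (s := s) (M := M))
        (l.comp (LinearMap.inl _ _ _))
      have hfrob (j : ℕ) (σ : B →ₐ[F] AlgebraicClosure F) :
          (fun p : RootCover (curveCoord e : Curve F B s n → _) M (fiberCoord e x₀) =>
            coord σ (((frobTorus F B)^[j] (p.torus hB e x₀)).1 : GeomAlg F B)) ∈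
          coordinateRing (RootCover.coords (c := (curveCoord e : Curve F B s n → _)) (M := M)
            (d := fiberCoord e x₀)) := by
        induction j generalizing σ with
        | zero =>
          obtain ⟨i, rfl⟩ := e.surjective σ
          exact coord_torus_mem_coordinateRing hB e x₀ i
        | succ j ih =>
          obtain ⟨σ, rfl⟩ := Finite.surjective_of_injective frobEmb_injective σ
          simp only [Function.iterate_succ_apply', coord_frobTorus]
          exact pow_mem (ih σ) _
      have hnorm (i : Fin 3) : (fun p : RootCover (curveCoord e : Curve F B s n → _) M
            (fiberCoord e x₀) =>
            coord (e i) ((frobNorm m (p.torus hB e x₀)).1 : GeomAlg F B)) ∈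
          coordinateRing (RootCover.coords (c := (curveCoord e : Curve F B s n → _)) (M := M)
            (d := fiberCoord e x₀)) := by
        convert prod_mem fun j (_ : j ∈ Finset.range m) => hfrob j (e i) using 1
        ext p
        simp only [frobNorm, Subgroup.val_finsetProd, Units.coe_prod, map_prod, Finset.prod_apply]
      have h2 := dual_mem hB e hnorm (l.comp (LinearMap.inr _ _ _))
      convert add_mem h1 h2 using 1
      ext p
      simp only [Pi.add_apply, LinearMap.comp_apply, LinearMap.inl_apply, LinearMap.inr_apply, P]
      rw [← map_add]
      simp) hf
  ext h
  -- A preimage of h among the M-torsion: take v with v^M = h and z = Lang(v). Then `frobNorm m z` =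
  -- v^M = h, while z^M = Lang(h) = 1 because h is rational.
  obtain ⟨v, hv⟩ := exists_torus_pow_eq hB e hM0 (rationalPoint F B h)
  set z := langMap F B v with hz
  have hNz : frobNorm m z = rationalPoint F B h := by rw [frobNorm_langMap, hpow, hv]
  have hzM : z ^ M = 1 := by rw [hz, ← map_pow, hv, langMap_rationalPoint]
  let ζ (i : Fin 3) : AlgebraicClosure F := coord (e i) (z.1 : GeomAlg F B)
  have h1 : ∏ i, ζ i = 1 := prod_coord_torus hB e z
  have hζ (i) : ζ i ^ M = 1 := by
    have := congrArg (fun t : normOneTorus (AlgebraicClosure F) (GeomAlg F B) =>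
      coord (e i) (t.1 : GeomAlg F B)) hzM
    simpa using this
  have hzζ : torusOfCoord hB e ζ h1 = z := torus_ext hB e fun i => coord_torusOfCoord hB e ζ h1 i
  have hPh : P (p.twist ζ h1 hζ) = h • P p := by
    apply Subtype.ext
    refine Prod.ext rfl ?_
    change frobNorm m ((p.twist ζ h1 hζ).torus hB e x₀) =
      rationalPoint F B h * frobNorm m (p.torus hB e x₀)
    rw [RootCover.torus_twist, frobNorm_mul, hzζ, hNz]
  have := hp ζ h1 hζ
  rw [hPh, hfχ] at this
  exact mul_right_cancel₀ (hf0 (P p)) (this.trans (one_mul _).symm)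

theorem lang_trivial_one : IsTrivialRankOne (LangCover s x₀) (1 : normOneTorus F B →* Eˣ) :=
  ⟨1, ⟨IsLocallyConstant.const 1, fun g w => by simp⟩, fun w => one_ne_zero⟩

end Lang

end TraceNorm

/-! ### The main theorem. -/

open TraceNorm in
theorem mainTheorem3 {F B : Type*} [Field F] [Fintype F] [CommRing B] [Algebra F B]
    [Module.Finite F B] [Algebra.Etale F B] (hB : Module.finrank F B = 3)
    (h2 : ringChar F ≠ 2) (h3 : ringChar F ≠ 3)
    (s : F) (n : Fˣ) (hsn : s ^ 3 ≠ 27 * (n : F)) :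
    -- Lang character sheaves
    (∀ (ℓ : ℕ) [Fact ℓ.Prime], ℓ ≠ ringChar F →
      ∀ (χ : normOneTorus F B →* (AlgebraicClosure ℚ_[ℓ])ˣ) (x₀ : NormFiber F B n),
        IsTrivialRankOne (LangCover s x₀) χ ↔ χ = 1) ∧
    -- geometric Kummer sheaves
    (∀ (ℓ : ℕ) [Fact ℓ.Prime], ℓ ≠ ringChar F →
      ∀ (e : Fin 3 ≃ (B →ₐ[F] AlgebraicClosure F)) (N : ℕ), N.Coprime (ringChar F) →
      ∀ (ψ : rootsOfUnity N (AlgebraicClosure F) →* (AlgebraicClosure ℚ_[ℓ])ˣ),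
        Function.Injective ψ →
      ∀ (a : Fin 3 → ℤ) (x₀ : NormFiber F B n),
        IsTrivialRankOne (KummerCover s e N a x₀) ψ ↔ ∀ i j, a i ≡ a j [ZMOD N]) ∧
    -- the function field
    IsDomain (CurveRing F B s n) ∧
    (∀ (e : Fin 3 ≃ (B →ₐ[F] AlgebraicClosure F)) (N : ℕ), N.Coprime (ringChar F) →
      ∀ a : Fin 3 → ℤ, ∃ f : (CurveRing F B s n)ˣ,
        (∀ x : Curve F B s n, f.1.1 x = monomial e a x.1.1) ∧
        ((∃ g : FractionRing (CurveRing F B s n),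
            g ^ N = algebraMap (CurveRing F B s n) _ f) ↔
          ∀ i j, a i ≡ a j [ZMOD N])) := by
  have hn : algebraMap F (AlgebraicClosure F) n ≠ 0 := by simp
  have hsn' : algebraMap F (AlgebraicClosure F) s ^ 3 ≠ 27 * algebraMap F (AlgebraicClosure F) n := by
    rw [← map_pow, ← map_ofNat (algebraMap F (AlgebraicClosure F)), ← map_mul]
    exact (algebraMap F (AlgebraicClosure F)).injective.ne hsn
  have hN0 {N : ℕ} (hN : N.Coprime (ringChar F)) : N ≠ 0 := by
    rintro rfl
    exact natCast_ne_zero_of_coprime hN Nat.cast_zero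
  obtain ⟨e₀⟩ := nonempty_equiv_algHom (F := F) (B := B) hB
  refine ⟨fun ℓ _ _ χ x₀ => ⟨eq_one_of_lang_trivial hB e₀ x₀ hsn, ?_⟩,
    fun ℓ _ _ e N hN ψ hψ a x₀ =>
      ⟨modEq_of_kummer_trivial hB e x₀ (natCast_ne_zero_of_coprime hN) hsn hψ,
        kummer_trivial_of_modEq hB e x₀ (hN0 hN) ψ⟩, ?_, fun e N hN a => ?_⟩
  · rintro rfl
    exact lang_trivial_one x₀
  · rw [curveRing_eq hB e₀]
    exact (isTraceNormCurve hB e₀ s n).isDomain hn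
  · have h := (isTraceNormCurve hB e s n).exists_unit_monomial hn hsn' (hN0 hN) a
    simp only [curveCoord, ← coe_monomial] at h
    rw [curveRing_eq hB e]
    exact h
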